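/- **Setting.** Let $M$ be a smooth $n$-dimensional manifold ($n\ge 1$; Hausdorff, second countable) with possibly empty boundary, $dx$ the measure of a volume form (a measure with smooth positive density in every chart), and $L$ a closed densely defined operator on $L^2(M)=L^2(M,dx)$, e.g. the realization of a boundary value problem for a pseudo-differential operator of order $\nu>0$. Assume that $\mathcal I$ is a non-empty countable index set and that there are eigenvalues $\lambda_\xi$, enumerated so that $|\lambda_\xi|$ is non-decreasing, and eigenfunctions $Lu_\xi=\lambda_\xi u_\xi$, $L^*v_\xi=\overline{\lambda_\xi}v_\xi$ ($\xi\in\mathcal I$) with $\|u_\xi\|_{L^2}=1$ and $(u_\xi,v_\eta)_{L^2}=\delta_{\xi\eta}$, such that every $f\in L^2(M)$ has a unique expansion $f=\sum_\xi a_\xi u_\xi$ converging in $L^2$ (partial sums in the given order). Put $\langle\xi\rangle=(1+|\lambda_\xi|^2)^{1/2\nu}$ with $\nu>0$, and assume that $\sum_\xi\langle\xi\rangle^{-s_0}<\infty$ for some $s_0\in\mathbb R$ and that, for some $Q>0$, the Weyl law holds in the form $N(r)=|\{\xi:\langle\xi\rangle\le r\}|=O(r^Q)$ as $r\to\infty$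 (in particular this holds if $N(r)\sim Cr^Q$). Let $C^\infty_L(M)=\bigcap_k\mathrm{Dom}(L^k)$ and $C^\infty_{L^*}(M)=\bigcap_k\mathrm{Dom}((L^*)^k)$, with the topologies given by the norms $\max_{j\le k}\|L^jf\|_{L^2}$, resp. $\max_{j\le k}\|(L^*)^jf\|_{L^2}$, let $\mathcal D'_L(M)$ be the space of continuous linear functionals on $C^\infty_{L^*}(M)$ (functions $\psi$ act by $\varphi\mapsto\int_M\psi\varphi\,dx$), and let $\widehat f(\xi)=\int_M f\,\overline{v_\xi}\,dx$. A continuous linear $A:C^\infty_L(M)\to\mathcal D'_L(M)$ has $L$-symbol $\sigma:M\times\mathcal I\to\mathbb C$ if $Af=\sum_\xi u_\xi\,\sigma(\cdot,\xi)\,\widehat f(\xi)$ in $\mathcal D'_L(M)$ for all $f\in C^\infty_L(M)$. A collection $q_1,\dots,q_l\in C^\infty(M\times M)$ is $L$-strongly admissible if each multiplication by $q_j(x,\cdot)$ is continuous on $C_L^\infty(M)$, the gradients $\nabla_yq_j(x,y)|_{y=x}$ span a space of rank $n$ for every $x$, and the $q_j(x,y)$ all vanish if and only if $x=y$. With $q^\alpha=\prod_jq_j^{\alpha_j}$,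 let $D^{(\alpha)}$ be operators satisfying $D^{(0)}=I$ and $\partial^\beta g(e)=\sum_{|\alpha|\le|\beta|}\frac1{\alpha!}\,\partial^\beta_y q^\alpha(e,y)|_{y=e}\,D^{(\alpha)}g(e)$ for smooth $g$, and let $\Delta^0=I$ and, for $\alpha\ne0$, $\Delta^\alpha_{(x)}a(x,\xi)=u_\xi(x)^{-1}\sum_\eta\widehat{q^\alpha(x,\cdot)u_\xi}(\eta)\,a(x,\eta)\,u_\eta(x)$ (only where $u_\xi(x)\neq0$, the series being required to converge absolutely there). For $m\in\mathbb R$ and $0\le\rho,\delta\le1$ the class $S^m_{\rho,\delta}(M\times\mathcal I)$ consists of the $a$ that are smooth in $x$ and satisfy $|\Delta^\alpha_{(x)}D^{(\beta)}_xa(x,\xi)|\le C_{\alpha\beta}\langle\xi\rangle^{m-\rho|\alpha|+\delta|\beta|}$ for all $\alpha,\beta$. Let $q>0$, and let $\mathcal M_q=(1+L^\circ L)^{q/2\nu}$, where $L^\circ u_\xi=\overline{\lambda_\xi}u_\xi$; thus $e^{-t\mathcal M_q}u_\xi=e^{-t\langle\xi\rangle^q}u_\xi$. **Theorem.** Let $m\in\mathbb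 R$. For every $A$ with $L$-symbol $\sigma\in S^m_{\rho,\delta}(M\times\mathcal I)$, for some $0\le\rho,\delta\le1$ and some admissible collection, and every $t>0$, the operator $Ae^{-t\mathcal M_q}$ is of trace class on $L^2(M)$. Write $|\sigma|_m=\sup_{x,\xi}\langle\xi\rangle^{-m}|\sigma(x,\xi)|$. The constants below depend on $L,Q,m,q$ (and on $t_0$ in (3)), but not on $A$, $\rho$, $\delta$, $t$. 1. There is $c>0$ with $$|\mathrm{Tr}(Ae^{-t\mathcal M_q})|\le c\,|\sigma|_m\,(1+t)\,t^{-\frac{Q+m}{q}}\int_{t^{1/q}}^\infty e^{-s^q}s^{Q+m-1}\,ds\qquad\text{for all }t>0;$$ in particular the estimate holds without the factor $1+t$ on every bounded interval $0<t\le T$, with a constant depending also on $T$. 2. If $0$ is not among the eigenvalues $\lambda_\xi$, there is $c>0$ with $$|\mathrm{Tr}(Ae^{-t\mathcal M_q})|\le c\,|\sigma|_m\,t^{-\frac{Q+m}{q}}\int_{t^{1/q}}^\infty e^{-s^q}s^{Q+m-1}\,ds\qquad\text{for all }t>0.$$ 3. If $m=-Q$, then for every $t_0\in(0,1)$ there is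 $c>0$ with $|\mathrm{Tr}(Ae^{-t\mathcal M_q})|\le -c\,|\sigma|_m\,\frac1q\log t$ for $0<t\le t_0$. 4. If $m>-Q$, there are $C>0$, real numbers $b_k$ and $t_0>0$ such that $\sum_kb_kt^{k/q}$ converges and $$|\mathrm{Tr}(Ae^{-t\mathcal M_q})|\le C\,|\sigma|_m\,t^{-\frac{Q+m}{q}}\sum_{k=0}^\infty b_kt^{k/q}\qquad\text{for }0<t<t_0.$$ -/

import Mathlib

open MeasureTheory Filter Topology
open scoped ENNReal ContDiff Manifold ComplexConjugate LinearPMap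

noncomputable section

namespace NonharmonicTrace

/-! ### Trace class operators -/

section TraceClass

variable {H : Type*} [NormedAddCommGroup H] [InnerProductSpace ℂ H]

/-- Trace class (= nuclear) operators on a Hilbert space: `T f = ∑ₖ (f, yₖ) xₖ` with
`∑ₖ ‖xₖ‖ ‖yₖ‖ < ∞`. -/
def IsTraceClass (T : H →L[ℂ] H) : Prop :=
  ∃ x y : ℕ → H, Summable (fun k => ‖x k‖ * ‖y k‖) ∧
    ∀ f : H, HasSum (fun k => (inner ℂ (y k) f : ℂ) • x k) (T f)

/-- `T` is of trace class and `τ` is its trace: `τ = ∑ᵢ (T eᵢ, eᵢ)` for every orthonormal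
basis `(eᵢ)` of `H`. -/
def HasTrace (T : H →L[ℂ] H) (τ : ℂ) : Prop :=
  IsTraceClass T ∧
    ∀ (s : Set H) (e : HilbertBasis s ℂ H), HasSum (fun i => (inner ℂ (e i) (T (e i)) : ℂ)) τ

end TraceClass

/-! ### Powers of an unbounded operator and the associated test functions -/

section Powers

variable {H : Type*} [NormedAddCommGroup H] [InnerProductSpace ℂ H]

open scoped Classical in
/-- The operator `T`, extended by `0` to vectors outside its domain. -/
def applyOp (T : H →ₗ.[ℂ] H) (f : H) : H :=
  if h : f ∈ T.domain then T ⟨f, h⟩ else 0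

theorem applyOp_of_mem (T : H →ₗ.[ℂ] H) {f : H} (h : f ∈ T.domain) :
    applyOp T f = T ⟨f, h⟩ := dif_pos h

theorem applyOp_add (T : H →ₗ.[ℂ] H) {f g : H} (hf : f ∈ T.domain) (hg : g ∈ T.domain) :
    applyOp T (f + g) = applyOp T f + applyOp T g := by
  rw [applyOp_of_mem T hf, applyOp_of_mem T hg, applyOp_of_mem T (T.domain.add_mem hf hg),
    ← LinearPMap.map_add]
  rfl

theorem applyOp_smul (T : H →ₗ.[ℂ] H) (c : ℂ) {f : H} (hf : f ∈ T.domain) :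
    applyOp T (c • f) = c • applyOp T f := by
  rw [applyOp_of_mem T hf, applyOp_of_mem T (T.domain.smul_mem c hf), ← LinearPMap.map_smul]
  rfl

theorem applyOp_zero (T : H →ₗ.[ℂ] H) : applyOp T 0 = 0 := by
  rw [applyOp_of_mem T T.domain.zero_mem]
  exact LinearPMap.map_zero T

theorem iterate_applyOp_add (T : H →ₗ.[ℂ] H) {f g : H}
    (hf : ∀ j : ℕ, (applyOp T)^[j] f ∈ T.domain) (hg : ∀ j : ℕ, (applyOp T)^[j] g ∈ T.domain)
    (j : ℕ) : (applyOp T)^[j] (f + g) = (applyOp T)^[j] f + (applyOp T)^[j] g := by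
  induction j with
  | zero => rfl
  | succ j ih =>
    rw [Function.iterate_succ_apply', Function.iterate_succ_apply', Function.iterate_succ_apply',
      ih, applyOp_add T (hf j) (hg j)]

theorem iterate_applyOp_smul (T : H →ₗ.[ℂ] H) (c : ℂ) {f : H}
    (hf : ∀ j : ℕ, (applyOp T)^[j] f ∈ T.domain) (j : ℕ) :
    (applyOp T)^[j] (c • f) = c • (applyOp T)^[j] f := by
  induction j with
  | zero => rfl
  | succ j ih =>
    rw [Function.iterate_succ_apply', Function.iterate_succ_apply', ih, applyOp_smul T c (hf j)]

theorem iterate_applyOp_zero (T : H →ₗ.[ℂ] H) (j : ℕ) : (applyOp T)^[j] 0 = 0 := by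
  induction j with
  | zero => rfl
  | succ j ih => rw [Function.iterate_succ_apply', ih, applyOp_zero]

/-- The space `⋂ₖ Dom(Tᵏ)`, where `Dom(Tᵏ)` consists of the `f` with `Tʲ f ∈ Dom(T)` for all
`j < k`. For `T = L` it is the space `C^∞_L` of test functions, for `T = L*` it is `C^∞_{L*}`. -/
def testSpace (T : H →ₗ.[ℂ] H) : Submodule ℂ H where
  carrier := {f | ∀ j : ℕ, (applyOp T)^[j] f ∈ T.domain}
  add_mem' := by
    intro f g hf hg j
    rw [iterate_applyOp_add T hf hg j]
    exact T.domain.add_mem (hf j) (hg j)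
  zero_mem' := by
    intro j
    rw [iterate_applyOp_zero]
    exact T.domain.zero_mem
  smul_mem' := by
    intro c f hf j
    rw [iterate_applyOp_smul T c hf j]
    exact T.domain.smul_mem c (hf j)

/-- The norm `max_{j ≤ k} ‖Tʲ f‖`. These norms define the Fréchet topology of `testSpace T`. -/
def testNorm (T : H →ₗ.[ℂ] H) (k : ℕ) (f : H) : ℝ :=
  (Finset.range (k + 1)).sup' Finset.nonempty_range_add_one (fun j => ‖(applyOp T)^[j] f‖)

end Powers

/-! ### The model operator -/

/-- A closed, densely defined operator `L` on `L²(M, μ)` (the realization of a boundary value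
problem) together with its eigenvalues `lam ξ`, its eigenfunctions `u ξ`, the eigenfunctions `v ξ`
of the adjoint `L*` and the order `ν > 0`. The index set `ι` carries the ordering by
`|lam ξ|` and has finite initial segments. -/
structure ModelOperator {M : Type*} [MeasurableSpace M] (μ : Measure M)
    (ι : Type*) [LinearOrder ι] [LocallyFiniteOrderBot ι] where
  /-- the operator -/
  L : Lp ℂ 2 μ →ₗ.[ℂ] Lp ℂ 2 μ
  dense_domain : Dense (L.domain : Set (Lp ℂ 2 μ))
  isClosed : L.IsClosed
  /-- the order of the operator -/
  ν : ℝ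
  ν_pos : 0 < ν
  /-- the eigenvalues -/
  lam : ι → ℂ
  norm_lam_mono : Monotone (fun ξ => ‖lam ξ‖)
  /-- the eigenfunctions of `L` -/
  u : ι → M → ℂ
  /-- the eigenfunctions of `L*` -/
  v : ι → M → ℂ
  memLp_u : ∀ ξ, MemLp (u ξ) 2 μ
  memLp_v : ∀ ξ, MemLp (v ξ) 2 μ
  eigen_u : ∀ ξ, ∃ h : (memLp_u ξ).toLp ∈ L.domain,
    L ⟨(memLp_u ξ).toLp, h⟩ = lam ξ • (memLp_u ξ).toLp
  eigen_v : ∀ ξ, ∃ h : (memLp_v ξ).toLp ∈ (L†).domain,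
    L† ⟨(memLp_v ξ).toLp, h⟩ = conj (lam ξ) • (memLp_v ξ).toLp
  norm_u : ∀ ξ, ‖(memLp_u ξ).toLp‖ = 1
  biorthogonal : ∀ ξ η, ∫ x, u ξ x * conj (v η x) ∂μ = if ξ = η then 1 else 0
  /-- every `f` is the limit of the partial sums `∑_{ξ ≤ N} a ξ u ξ` for a unique family `a` -/
  basis : ∀ f : Lp ℂ 2 μ, ∃! a : ι → ℂ,
    Tendsto (fun N => ∑ ξ ∈ Finset.Iic N, a ξ • (memLp_u ξ).toLp) atTop (𝓝 f)
  summable_bracket : ∃ s₀ : ℝ, Summable (fun ξ => ((1 + ‖lam ξ‖ ^ 2) ^ (1 / (2 * ν))) ^ (-s₀))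

namespace ModelOperator

variable {M : Type*} [MeasurableSpace M] {μ : Measure M}
  {ι : Type*} [LinearOrder ι] [LocallyFiniteOrderBot ι] (D : ModelOperator μ ι)

/-- `⟨ξ⟩ = (1 + |λ_ξ|²)^{1/(2ν)}`. -/
def bracket (ξ : ι) : ℝ := (1 + ‖D.lam ξ‖ ^ 2) ^ (1 / (2 * D.ν))

/-- `N(r)`, the number of indices `ξ` with `⟨ξ⟩ ≤ r`. -/
def counting (r : ℝ) : ℕ := Nat.card {ξ : ι // D.bracket ξ ≤ r}

/-- The (upper) Weyl law `N(r) = O(r^Q)` as `r → ∞`. -/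
def WeylLaw (Q : ℝ) : Prop :=
  (fun r : ℝ => (D.counting r : ℝ)) =O[atTop] (fun r : ℝ => r ^ Q)

/-- The `L`-Fourier coefficient `∫ f conj(v_ξ)`. -/
def fourier (f : M → ℂ) (ξ : ι) : ℂ := ∫ x, f x * conj (D.v ξ x) ∂μ

/-- The eigenvalue of `M_q = (1 + L° L)^{q/(2ν)}` on `u_ξ`; recall `L° u_ξ = conj(λ_ξ) u_ξ`, so that
`L° L u_ξ = |λ_ξ|² u_ξ`. -/
def modulus (q : ℝ) (ξ : ι) : ℝ := (1 + ‖D.lam ξ‖ ^ 2) ^ (q / (2 * D.ν))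

/-- The heat semigroup `e^{-t M_q}` on `L²(M)`, the operator that multiplies the coefficient of
`u_ξ` by the function `e^{-t (·)}` of the eigenvalue of `M_q`. -/
def heat (q t : ℝ) (f : Lp ℂ 2 μ) : Lp ℂ 2 μ :=
  ∑' ξ, ((Real.exp (-t * D.modulus q ξ) : ℂ) * D.fourier f ξ) • (D.memLp_u ξ).toLp

/-- A linear operator from `C^∞_L` to the linear functionals on `C^∞_{L*}`. -/
abbrev Operator : Type _ := testSpace D.L →ₗ[ℂ] (testSpace (D.L†) →ₗ[ℂ] ℂ)

/-- `A` takes values in the space `D'_L` of continuous functionals on `C^∞_{L*}`, and it is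
continuous from `C^∞_L` to `D'_L`. -/
def IsContinuousOperator (A : D.Operator) : Prop :=
  (∀ f, ∃ (k : ℕ) (C : ℝ), ∀ φ, ‖A f φ‖ ≤ C * testNorm (D.L†) k φ) ∧
  (∀ φ, ∃ (k : ℕ) (C : ℝ), ∀ f, ‖A f φ‖ ≤ C * testNorm D.L k f)

/-- `A` has the `L`-symbol `σ`, i.e. `A f = ∑_ξ f̂(ξ) σ(·, ξ) u_ξ` for all `f ∈ C^∞_L`, in the sense
of `L`-distributions (a function `ψ` is identified with the distribution `φ ↦ ∫ ψ φ`). -/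
def HasSymbol (A : D.Operator) (σ : M → ι → ℂ) : Prop :=
  ∀ (f : testSpace D.L) (φ : testSpace (D.L†)),
    HasSum (fun ξ => D.fourier (f : Lp ℂ 2 μ) ξ *
      ∫ x, (D.u ξ x * σ x ξ) * (φ : Lp ℂ 2 μ) x ∂μ) (A f φ)

/-- `A e^{-t M_q}` extends to (is) a trace class operator `T` on `L²(M)`, with trace `τ`. -/
def HasHeatTrace (A : D.Operator) (q t : ℝ) (τ : ℂ) : Prop :=
  ∃ T : Lp ℂ 2 μ →L[ℂ] Lp ℂ 2 μ,
    (∀ f : Lp ℂ 2 μ, ∃ h : D.heat q t f ∈ testSpace D.L, ∀ φ : testSpace (D.L†),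
      A ⟨D.heat q t f, h⟩ φ = ∫ x, T f x * (φ : Lp ℂ 2 μ) x ∂μ) ∧
    HasTrace T τ

end ModelOperator

/-! ### Smooth measures, difference operators, symbol classes -/

section Manifold

variable (n : ℕ) [NeZero n] {M : Type*} [TopologicalSpace M]
  [ChartedSpace (EuclideanHalfSpace n) M]

/-- `μ` is the measure of a volume form: in every chart it has a smooth positive density with
respect to Lebesgue measure. -/
def IsVolumeMeasure [MeasurableSpace M] (μ : Measure M) : Prop :=
  ∀ p : M, ∃ w : EuclideanSpace ℝ (Fin n) → ℝ,
    ContDiffOn ℝ ∞ w (extChartAt (𝓡∂ n) p).target ∧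
    (∀ z ∈ (extChartAt (𝓡∂ n) p).target, 0 < w z) ∧
    ∀ s : Set M, MeasurableSet s → s ⊆ (extChartAt (𝓡∂ n) p).source →
      μ s = ∫⁻ z in extChartAt (𝓡∂ n) p '' s, ENNReal.ofReal (w z)

/-- The `i`-th partial derivative on the closed half space (at boundary points: from within the
half space). -/
def pderiv (i : Fin n) (G : EuclideanSpace ℝ (Fin n) → ℂ) : EuclideanSpace ℝ (Fin n) → ℂ :=
  fun z => fderivWithin ℝ G (Set.range (𝓡∂ n)) z (EuclideanSpace.single i 1)

/-- `∂^β g` at the point `e`, in the preferred chart at `e`. -/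
def chartDeriv (β : Fin n → ℕ) (g : M → ℂ) (e : M) : ℂ :=
  ((List.finRange n).foldr (fun i G => (pderiv n i)^[β i] G) (g ∘ (extChartAt (𝓡∂ n) e).symm))
    (extChartAt (𝓡∂ n) e e)

/-- An `L`-strongly admissible collection `q₁, …, q_l` and the operators `D^(α)` of the Taylor
expansions with respect to it. -/
structure AdmissibleCollection [MeasurableSpace M] {μ : Measure M}
    {ι : Type*} [LinearOrder ι] [LocallyFiniteOrderBot ι] (D : ModelOperator μ ι) where
  /-- the number of functions -/
  l : ℕ
  /-- the functions -/
  q : Fin l → M → M → ℂ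
  smooth : ∀ j, ContMDiff ((𝓡∂ n).prod (𝓡∂ n)) 𝓘(ℝ, ℂ) ∞ (fun p : M × M => q j p.1 p.2)
  /-- multiplication by `q_j(x, ·)` is a continuous linear map of `C^∞_L` -/
  mul_continuous : ∀ (j : Fin l) (x : M), ∃ S : testSpace D.L →ₗ[ℂ] testSpace D.L,
    (∀ f, (S f : Lp ℂ 2 μ) =ᵐ[μ] fun y => q j x y * (f : Lp ℂ 2 μ) y) ∧
    ∀ k : ℕ, ∃ (k' : ℕ) (C : ℝ), ∀ f, testNorm D.L k (S f) ≤ C * testNorm D.L k' f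
  rank_eq : ∀ x : M, (Matrix.of fun (i : Fin n) (j : Fin l) =>
    chartDeriv n (Pi.single i 1) (q j x) x).rank = n
  zero_iff : ∀ x y : M, (∀ j, q j x y = 0) ↔ x = y
  /-- the operators `D^(α)` -/
  Dop : (Fin l → ℕ) → (M → ℂ) → (M → ℂ)
  Dop_zero : ∀ g, Dop 0 g = g
  /-- `∂^β g(e) = ∑_{|α| ≤ |β|} (1/α!) ∂^β[q^α(e, ·)](e) D^(α) g(e)` -/
  taylor : ∀ g : M → ℂ, ContMDiff (𝓡∂ n) 𝓘(ℝ, ℂ) ∞ g → ∀ (e : M) (β : Fin n → ℕ),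
    chartDeriv n β g e = ∑ k ∈ Finset.range (∑ i, β i + 1),
      ∑ α ∈ Finset.piAntidiag (Finset.univ : Finset (Fin l)) k,
        (1 / (∏ j, (Nat.factorial (α j) : ℂ))) *
          chartDeriv n β (fun y => ∏ j, q j e y ^ α j) e * Dop α g e

namespace AdmissibleCollection

variable {n} [MeasurableSpace M] {μ : Measure M}
    {ι : Type*} [LinearOrder ι] [LocallyFiniteOrderBot ι] {D : ModelOperator μ ι}
    (S : AdmissibleCollection n D)

/-- `q^α(x, y)`. -/
def qpow (α : Fin S.l → ℕ) (x y : M) : ℂ := ∏ j, S.q j x y ^ α j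

/-- The summands of `∑_η F_L(q^α(x, ·) u_ξ)(η) a(x, η) u_η(x)`. -/
def diffTerm (α : Fin S.l → ℕ) (a : M → ι → ℂ) (x : M) (ξ η : ι) : ℂ :=
  D.fourier (fun y => S.qpow α x y * D.u ξ y) η * a x η * D.u η x

open scoped Classical in
/-- The difference operator
`Δ^α a(x, ξ) = u_ξ(x)⁻¹ ∑_η F_L(q^α(x, ·) u_ξ)(η) a(x, η) u_η(x)`; for `α = 0` it is the identity.
(For `α ≠ 0` it has the value `0` at the zeros of `u_ξ`, where the formula has no meaning.) -/
def diffOp (α : Fin S.l → ℕ) (a : M → ι → ℂ) (x : M) (ξ : ι) : ℂ :=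
  if α = 0 then a x ξ else (D.u ξ x)⁻¹ * ∑' η, S.diffTerm α a x ξ η

/-- `D_x^(β) a`. -/
def DopSymbol (β : Fin S.l → ℕ) (a : M → ι → ℂ) : M → ι → ℂ :=
  fun x ξ => S.Dop β (fun y => a y ξ) x

/-- The symbol class `S^m_{ρ,δ}(M × I)`. -/
def symbolClass (m ρ δ : ℝ) : Set (M → ι → ℂ) :=
  {a | (∀ ξ, ContMDiff (𝓡∂ n) 𝓘(ℝ, ℂ) ∞ (fun x => a x ξ)) ∧
    ∀ α β : Fin S.l → ℕ,
      (∀ x ξ, α ≠ 0 → D.u ξ x ≠ 0 → Summable (S.diffTerm α (S.DopSymbol β a) x ξ)) ∧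
      ∃ C : ℝ, ∀ x ξ, ‖S.diffOp α (S.DopSymbol β a) x ξ‖ ≤
        C * D.bracket ξ ^ (m - ρ * ((∑ j, α j : ℕ) : ℝ) + δ * ((∑ j, β j : ℕ) : ℝ))}

end AdmissibleCollection

/-- A continuous linear operator `A : C^∞_L → D'_L` with `L`-symbol in `S^m_{ρ,δ}(M × I)` for some
`ρ, δ ∈ [0, 1]`. -/
structure PseudoOperator [MeasurableSpace M] {μ : Measure M}
    {ι : Type*} [LinearOrder ι] [LocallyFiniteOrderBot ι] (D : ModelOperator μ ι) (m : ℝ) where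
  /-- the operator -/
  A : D.Operator
  continuous : D.IsContinuousOperator A
  /-- the collection that defines the difference operators -/
  S : AdmissibleCollection n D
  /-- the first type index -/
  ρ : ℝ
  /-- the second type index -/
  δ : ℝ
  ρ_mem : ρ ∈ Set.Icc (0 : ℝ) 1
  δ_mem : δ ∈ Set.Icc (0 : ℝ) 1
  /-- the symbol -/
  σ : M → ι → ℂ
  σ_mem : σ ∈ S.symbolClass m ρ δ
  hasSymbol : D.HasSymbol A σ

/-- The seminorm `sup_{x, ξ} ⟨ξ⟩^{-m} |σ(x, ξ)|` of the symbol. -/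
def PseudoOperator.seminorm {n} [NeZero n] {M : Type*} [TopologicalSpace M]
    [ChartedSpace (EuclideanHalfSpace n) M] [MeasurableSpace M] {μ : Measure M}
    {ι : Type*} [LinearOrder ι] [LocallyFiniteOrderBot ι] {D : ModelOperator μ ι} {m : ℝ}
    (P : PseudoOperator n D m) : ℝ :=
  ⨆ p : M × ι, ‖P.σ p.1 p.2‖ / D.bracket p.2 ^ m

end Manifold

/-- `t^{-(Q+m)/q} ∫_{t^{1/q}}^∞ e^{-s^q} s^{Q+m-1} ds`. -/
def heatBound (Q m q t : ℝ) : ℝ :=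
  t ^ (-((Q + m) / q)) *
    ∫ s in Set.Ioi (t ^ (1 / q)), Real.exp (-(s ^ q)) * s ^ (Q + m - 1)

end NonharmonicTrace

end

/-!
The eigenfunctions `u ξ` form a Schauder basis of `L²(M)` whose coefficient functionals are
`f ↦ (f, v ξ)`. For each `f` the coefficients are bounded, as differences of consecutive partial
sums of a convergent series of multiples of unit vectors, so the uniform boundedness principle gives
`K = sup ‖v ξ‖ < ∞` (`exists_norm_vLp_le`). Hence
`A e^{-t M_q} = ∑ e^{-t ⟨ξ⟩^q} (·, v ξ) σ(·, ξ) u ξ` is a sum of operators of rank one with norms at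
most `K |σ|_m e^{-t ⟨ξ⟩^q} ⟨ξ⟩^m`. It is therefore nuclear, and by Bessel's inequality its trace in
any orthonormal basis is `∑ e^{-t ⟨ξ⟩^q} (σ(·, ξ) u ξ, v ξ)` (`hasTrace_of_nuclear`). Since `L` is
closed, `e^{-t M_q}` maps into `C^∞_L`; since the `v ξ` lie in `C^∞_{L*}` and are total, the
bounded extension of `A e^{-t M_q}` is unique. This yields
`|Tr (A e^{-t M_q})| ≤ K |σ|_m ∑ e^{-t ⟨ξ⟩^q} ⟨ξ⟩^m` (`exists_heatTrace_norm_le`).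

After the substitution `s = t^{1/q} r` the bound of the theorem is
`H(t) = ∫₁^∞ e^{-t r^q} r^{Q+m-1} dr`. For `κ > 1` a term with `⟨ξ⟩ ≥ κ` is at most a constant times
the integral of `e^{-t r^q} r^{m-1}` over `(⟨ξ⟩/κ, ⟨ξ⟩]`, an interval inside `(1, ∞)`, and by the
Weyl law a point `r` lies in at most `N(κ r) = O(r^Q)` of these intervals; so these terms sum to
`O(H(t))` (`exists_sum_le_heatBound`). If `0` is not an eigenvalue, one `κ` serves for all `ξ`.
Otherwise the finitely many terms with `⟨ξ⟩ < 2` are `O(e^{-t})`, and `e^{-t} = O((1 + t) H(t))`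
because `t r^q - t` stays bounded for `1 ≤ r ≤ 1 + 1/(1 + t)` (`exists_exp_neg_le_integral`).
The bounds for small `t` follow by estimating the integral near its lower limit `t^{1/q}`: it
diverges like `-(1/q) log t` if `m = -Q`, and converges if `m > -Q`, when the constant `b 0` alone
suffices.
-/

namespace NonharmonicTrace

/-! ### Nuclear sums and their trace -/

section Nuclear

variable {H : Type*} [NormedAddCommGroup H] [InnerProductSpace ℂ H]

/-- Cauchy–Schwarz and Bessel: the products of the coefficients of two vectors with respect to an
orthonormal family are absolutely summable, with a bound independent of the family. -/
theorem sum_norm_inner_mul_inner_le {κ : Type*} {e : κ → H} (he : Orthonormal ℂ e) (x y : H)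
    (F : Finset κ) :
    ∑ i ∈ F, ‖(inner ℂ y (e i) : ℂ) * inner ℂ (e i) x‖ ≤ ‖x‖ * ‖y‖ := by
  have h1 := he.sum_inner_products_le y (s := F)
  have h2 := he.sum_inner_products_le x (s := F)
  calc ∑ i ∈ F, ‖(inner ℂ y (e i) : ℂ) * inner ℂ (e i) x‖
      = ∑ i ∈ F, ‖(inner ℂ (e i) y : ℂ)‖ * ‖(inner ℂ (e i) x : ℂ)‖ := by
        refine Finset.sum_congr rfl fun i _ => ?_
        rw [norm_mul, norm_inner_symm]
    _ ≤ √(∑ i ∈ F, ‖(inner ℂ (e i) y : ℂ)‖ ^ 2) * √(∑ i ∈ F, ‖(inner ℂ (e i) x : ℂ)‖ ^ 2) :=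
        Real.sum_mul_le_sqrt_mul_sqrt _ _ _
    _ ≤ ‖y‖ * ‖x‖ := by
        gcongr
        · exact Real.sqrt_le_iff.2 ⟨norm_nonneg _, h1⟩
        · exact Real.sqrt_le_iff.2 ⟨norm_nonneg _, h2⟩
    _ = ‖x‖ * ‖y‖ := mul_comm _ _

/-- An operator `f ↦ ∑ (f, y k) x k` with `∑ ‖x k‖ ‖y k‖ < ∞` over a countable index set is of trace
class, and its trace is `∑ (x k, y k)`: by Bessel's inequality the double family
`(e i, y k) (x k, e i)` is absolutely summable, so that the order of summation may be exchanged. -/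
theorem hasTrace_of_nuclear {κ : Type*} [Countable κ] (T : H →L[ℂ] H) (x y : κ → H)
    (hs : Summable fun k => ‖x k‖ * ‖y k‖)
    (hT : ∀ f, HasSum (fun k => (inner ℂ (y k) f : ℂ) • x k) (T f)) :
    HasTrace T (∑' k, inner ℂ (y k) (x k)) := by
  refine ⟨?_, fun s e => ?_⟩
  · obtain ⟨g, hg⟩ := exists_injective_nat κ
    have key : ∀ m, m ∉ Set.range g → Function.extend g x 0 m = 0 := fun m hm =>
      Function.extend_apply' _ _ _ hm
    refine ⟨Function.extend g x 0, Function.extend g y 0, ?_, fun f => ?_⟩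
    · refine (hg.summable_iff fun m hm => ?_).1 ?_
      · simp [key m hm]
      · simpa [Function.comp_def, hg.extend_apply] using hs
    · refine (hg.hasSum_iff fun m hm => ?_).1 ?_
      · simp [key m hm]
      · simpa [Function.comp_def, hg.extend_apply] using hT f
  · set F : κ × s → ℂ := fun p => (inner ℂ (y p.1) (e p.2) : ℂ) * inner ℂ (e p.2) (x p.1) with hF
    have hrow : ∀ k, Summable fun i => ‖F (k, i)‖ := fun k =>
      summable_of_sum_le (fun _ => norm_nonneg _)
        (sum_norm_inner_mul_inner_le e.orthonormal (x k) (y k))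
    have hFs : Summable F := by
      refine Summable.of_norm ((summable_prod_of_nonneg fun _ => norm_nonneg _).2 ⟨hrow, ?_⟩)
      refine Summable.of_nonneg_of_le (fun k => tsum_nonneg fun _ => norm_nonneg _) (fun k => ?_) hs
      exact (hrow k).tsum_le_of_sum_le
        (sum_norm_inner_mul_inner_le e.orthonormal (x k) (y k))
    have h1 : HasSum (fun k => (inner ℂ (y k) (x k) : ℂ)) (∑' p, F p) :=
      hFs.hasSum.prod_fiberwise fun k => e.hasSum_inner_mul_inner (y k) (x k)
    rw [h1.tsum_eq]
    have h2 : HasSum (fun p : s × κ => F p.swap) (∑' p, F p) :=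
      (Equiv.prodComm s κ).hasSum_iff.2 hFs.hasSum
    refine h2.prod_fiberwise fun i => ?_
    have h3 := (hT (e i)).mapL (innerSL ℂ (e i))
    simpa [hF, Function.comp_def, inner_smul_right] using h3

/-- Every absolutely convergent sum of operators of rank one defines a bounded operator. -/
theorem exists_nuclear [CompleteSpace H] {κ : Type*} (x y : κ → H)
    (hs : Summable fun k => ‖x k‖ * ‖y k‖) :
    ∃ T : H →L[ℂ] H, ∀ f, HasSum (fun k => (inner ℂ (y k) f : ℂ) • x k) (T f) := by
  have h : Summable fun k => (innerSL ℂ (y k)).smulRight (x k) := by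
    refine Summable.of_norm (hs.congr fun k => ?_)
    rw [ContinuousLinearMap.norm_smulRight_apply, innerSL_apply_norm, mul_comm]
  refine ⟨∑' k, (innerSL ℂ (y k)).smulRight (x k), fun f => ?_⟩
  have h1 := h.hasSum.mapL (ContinuousLinearMap.apply ℂ H f)
  simpa using h1

theorem HasTrace.unique [CompleteSpace H] {T : H →L[ℂ] H} {τ τ' : ℂ} (h : HasTrace T τ)
    (h' : HasTrace T τ') : τ = τ' := by
  obtain ⟨w, b, -⟩ := exists_hilbertBasis ℂ H
  exact (h.2 w b).unique (h'.2 w b)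

end Nuclear

/-! ### The biorthogonal system -/

namespace ModelOperator

variable {M : Type*} [MeasurableSpace M] {μ : Measure M}
  {ι : Type*} [LinearOrder ι] [LocallyFiniteOrderBot ι] (D : ModelOperator μ ι)

/-- The eigenfunction `u ξ` as an element of `L²`. -/
noncomputable def uLp (ξ : ι) : Lp ℂ 2 μ := (D.memLp_u ξ).toLp

/-- The eigenfunction `v ξ` of the adjoint as an element of `L²`. -/
noncomputable def vLp (ξ : ι) : Lp ℂ 2 μ := (D.memLp_v ξ).toLp

theorem norm_uLp (ξ : ι) : ‖D.uLp ξ‖ = 1 := D.norm_u ξ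

theorem fourier_eq_inner (f : Lp ℂ 2 μ) (ξ : ι) : D.fourier f ξ = inner ℂ (D.vLp ξ) f := by
  rw [L2.inner_def]
  refine integral_congr_ae ?_
  filter_upwards [(D.memLp_v ξ).coeFn_toLp] with x hx
  rw [RCLike.inner_apply, vLp, hx]

theorem inner_vLp_uLp (η ξ : ι) :
    (inner ℂ (D.vLp η) (D.uLp ξ) : ℂ) = if ξ = η then 1 else 0 := by
  rw [← D.biorthogonal, ← fourier_eq_inner]
  refine integral_congr_ae ?_
  filter_upwards [(D.memLp_u ξ).coeFn_toLp] with x hx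
  rw [uLp, hx]

variable (ι) in
theorem countable_index : Countable ι := by
  refine Function.Injective.countable (f := fun ξ : ι => (Finset.Iic ξ).card) ?_
  refine StrictMono.injective fun a b hab => Finset.card_lt_card ?_
  exact Finset.Iic_ssubset_Iic.2 hab

variable [Nonempty ι]

/-- The coefficients of the eigenfunction expansion are the `L`-Fourier coefficients. -/
theorem tendsto_partialSum (f : Lp ℂ 2 μ) :
    Tendsto (fun N => ∑ ξ ∈ Finset.Iic N, (inner ℂ (D.vLp ξ) f : ℂ) • D.uLp ξ) atTop (𝓝 f) := by
  obtain ⟨a, ha, -⟩ := D.basis f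
  suffices h : ∀ η, a η = inner ℂ (D.vLp η) f by
    simp only [← h]
    exact ha
  intro η
  have h1 : Tendsto (fun N => (inner ℂ (D.vLp η) (∑ ξ ∈ Finset.Iic N, a ξ • D.uLp ξ) : ℂ))
      atTop (𝓝 (inner ℂ (D.vLp η) f)) := ((innerSL ℂ (D.vLp η)).continuous.tendsto f).comp ha
  refine tendsto_nhds_unique (tendsto_const_nhds.congr' ?_) h1
  filter_upwards [eventually_ge_atTop η] with N hN
  simp [inner_sum, inner_smul_right, inner_vLp_uLp, hN]

theorem eq_zero_of_inner_vLp_eq_zero {f : Lp ℂ 2 μ} (h : ∀ ξ, (inner ℂ (D.vLp ξ) f : ℂ) = 0) :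
    f = 0 := by
  have h1 := D.tendsto_partialSum f
  simp only [h, zero_smul, Finset.sum_const_zero] at h1
  exact tendsto_nhds_unique h1 tendsto_const_nhds

/-- For each `f` the coefficients of the expansion are bounded, being differences of consecutive
partial sums of a convergent sequence. -/
theorem exists_norm_inner_vLp_le (f : Lp ℂ 2 μ) :
    ∃ C : ℝ, ∀ ξ, ‖(inner ℂ (D.vLp ξ) f : ℂ)‖ ≤ C := by
  have h1 := (D.tendsto_partialSum f).norm
  obtain ⟨N₀, hN₀⟩ := eventually_atTop.1
    (h1.eventually (eventually_le_nhds (lt_add_one ‖f‖)))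
  have hpos : 0 ≤ ∑ ξ ∈ Finset.Iic N₀, ‖(inner ℂ (D.vLp ξ) f : ℂ)‖ :=
    Finset.sum_nonneg fun _ _ => norm_nonneg _
  refine ⟨2 * (‖f‖ + 1) + ∑ ξ ∈ Finset.Iic N₀, ‖(inner ℂ (D.vLp ξ) f : ℂ)‖, fun ξ => ?_⟩
  rcases le_or_gt ξ N₀ with hξ | hξ
  · have : ‖(inner ℂ (D.vLp ξ) f : ℂ)‖ ≤ _ := Finset.single_le_sum (f := fun ξ => ‖(inner ℂ (D.vLp ξ) f : ℂ)‖)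
      (fun _ _ => norm_nonneg _) (Finset.mem_Iic.2 hξ)
    have := norm_nonneg f
    linarith
  · have hne : (Finset.Iio ξ).Nonempty := ⟨N₀, Finset.mem_Iio.2 hξ⟩
    -- the predecessor of `ξ`
    set p := (Finset.Iio ξ).max' hne with hp
    have hpξ : p < ξ := Finset.mem_Iio.1 (Finset.max'_mem _ hne)
    have hNp : N₀ ≤ p := Finset.le_max' _ _ (Finset.mem_Iio.2 hξ)
    have hIic : Finset.Iic ξ = insert ξ (Finset.Iic p) := by
      ext η
      simp only [Finset.mem_Iic, Finset.mem_insert]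
      refine ⟨fun h => ?_, fun h => h.elim (fun h => h.le) fun h => h.trans hpξ.le⟩
      rcases h.lt_or_eq with h | h
      · exact Or.inr (Finset.le_max' _ _ (Finset.mem_Iio.2 h))
      · exact Or.inl h
    have hterm : (inner ℂ (D.vLp ξ) f : ℂ) • D.uLp ξ =
        ∑ η ∈ Finset.Iic ξ, (inner ℂ (D.vLp η) f : ℂ) • D.uLp η -
          ∑ η ∈ Finset.Iic p, (inner ℂ (D.vLp η) f : ℂ) • D.uLp η := by
      rw [hIic, Finset.sum_insert (by simpa using hpξ), add_sub_cancel_right]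
    have h2 : ‖(inner ℂ (D.vLp ξ) f : ℂ)‖ = ‖(inner ℂ (D.vLp ξ) f : ℂ) • D.uLp ξ‖ := by
      rw [norm_smul, norm_uLp, mul_one]
    rw [h2, hterm]
    refine (norm_sub_le _ _).trans ?_
    have := hN₀ ξ hξ.le
    have := hN₀ p hNp
    linarith

/-- The uniform boundedness principle: the eigenfunctions of the adjoint are bounded in `L²`. -/
theorem exists_norm_vLp_le : ∃ K : ℝ, 0 < K ∧ ∀ ξ, ‖D.vLp ξ‖ ≤ K := by
  obtain ⟨K, hK⟩ := banach_steinhaus (g := fun ξ => innerSL ℂ (D.vLp ξ)) fun f => by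
    simpa using D.exists_norm_inner_vLp_le f
  refine ⟨max K 1, by positivity, fun ξ => ?_⟩
  have := hK ξ
  rw [innerSL_apply_norm] at this
  exact this.trans (le_max_left _ _)

end ModelOperator

end NonharmonicTrace

namespace NonharmonicTrace

/-! ### Summability against the heat multiplier -/

theorem exists_exp_neg_mul_rpow_le {q t : ℝ} (hq : 0 < q) (ht : 0 < t) (p : ℝ) :
    ∃ C : ℝ, ∀ x : ℝ, 1 ≤ x → Real.exp (-t * x ^ q) ≤ C * x ^ p := by
  obtain ⟨k, hk⟩ := exists_nat_ge (-p / q)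
  refine ⟨k.factorial / t ^ k, fun x hx => ?_⟩
  have hx0 : 0 < x := by linarith
  have h1 := Real.pow_div_factorial_le_exp (t * x ^ q) (by positivity) k
  have h2 : x ^ (-p) ≤ (x ^ q) ^ k := by
    rw [← Real.rpow_natCast, ← Real.rpow_mul hx0.le]
    refine Real.rpow_le_rpow_of_exponent_le hx ?_
    rw [div_le_iff₀ hq] at hk
    linarith
  have hfac : (0 : ℝ) < k.factorial := by positivity
  rw [neg_mul, Real.exp_neg, inv_le_comm₀ (Real.exp_pos _) (by positivity)]
  refine le_trans ?_ h1
  rw [mul_inv, inv_div, ← Real.rpow_neg hx0.le, mul_pow, div_mul_eq_mul_div]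
  gcongr

namespace ModelOperator

variable {M : Type*} [MeasurableSpace M] {μ : Measure M}
  {ι : Type*} [LinearOrder ι] [LocallyFiniteOrderBot ι] (D : ModelOperator μ ι)

theorem one_le_bracket (ξ : ι) : 1 ≤ D.bracket ξ := by
  have := D.ν_pos
  exact Real.one_le_rpow (by nlinarith [sq_nonneg ‖D.lam ξ‖]) (by positivity)

theorem bracket_pos (ξ : ι) : 0 < D.bracket ξ := by linarith [D.one_le_bracket ξ]

theorem modulus_eq_bracket_rpow (q : ℝ) (ξ : ι) : D.modulus q ξ = D.bracket ξ ^ q := by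
  rw [modulus, bracket, ← Real.rpow_mul (by positivity)]
  congr 1
  ring

theorem norm_lam_le_bracket_rpow (ξ : ι) : ‖D.lam ξ‖ ≤ D.bracket ξ ^ D.ν := by
  have hν := D.ν_pos
  rw [bracket, ← Real.rpow_mul (by positivity),
    show 1 / (2 * D.ν) * D.ν = 1 / 2 by field_simp, ← Real.sqrt_eq_rpow]
  exact Real.le_sqrt_of_sq_le (by linarith)

theorem summable_exp_modulus_mul_bracket_rpow {q t : ℝ} (hq : 0 < q) (ht : 0 < t) (p : ℝ) :
    Summable fun ξ => Real.exp (-t * D.modulus q ξ) * D.bracket ξ ^ p := by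
  obtain ⟨s₀, hs⟩ := D.summable_bracket
  obtain ⟨C, hC⟩ := exists_exp_neg_mul_rpow_le hq ht (-s₀ - p)
  refine Summable.of_nonneg_of_le (fun ξ => ?_) (fun ξ => ?_) (hs.mul_left C)
  · have := D.bracket_pos ξ
    positivity
  · have hb := D.bracket_pos ξ
    rw [modulus_eq_bracket_rpow]
    calc Real.exp (-t * D.bracket ξ ^ q) * D.bracket ξ ^ p
        ≤ C * D.bracket ξ ^ (-s₀ - p) * D.bracket ξ ^ p := by
          gcongr
          exact hC _ (D.one_le_bracket ξ)
      _ = C * D.bracket ξ ^ (-s₀) := by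
          rw [mul_assoc, ← Real.rpow_add hb]
          ring_nf

/-! ### Test functions given by rapidly decreasing coefficients -/

theorem uLp_mem_domain (ξ : ι) : D.uLp ξ ∈ D.L.domain := (D.eigen_u ξ).1

theorem applyOp_uLp (ξ : ι) : applyOp D.L (D.uLp ξ) = D.lam ξ • D.uLp ξ := by
  obtain ⟨h, h'⟩ := D.eigen_u ξ
  rw [uLp, applyOp_of_mem _ h, h']

theorem vLp_mem_testSpace (ξ : ι) : D.vLp ξ ∈ testSpace (D.L†) := by
  obtain ⟨h, h'⟩ := D.eigen_v ξ
  have hv : D.vLp ξ ∈ (D.L†).domain := h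
  have key : ∀ j : ℕ, (applyOp (D.L†))^[j] (D.vLp ξ) = (conj (D.lam ξ)) ^ j • D.vLp ξ := by
    intro j
    induction j with
    | zero => simp
    | succ j ih =>
      rw [Function.iterate_succ_apply', ih, applyOp_smul _ _ hv]
      rw [show applyOp (D.L†) (D.vLp ξ) = conj (D.lam ξ) • D.vLp ξ by
        rw [vLp, applyOp_of_mem _ h, h'], smul_smul, pow_succ]
  intro j
  rw [key]
  exact (D.L†).domain.smul_mem _ hv

theorem summable_smul_uLp {c : ι → ℂ} (hc : Summable fun ξ => ‖c ξ‖) :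
    Summable fun ξ => c ξ • D.uLp ξ :=
  Summable.of_norm (hc.congr fun ξ => by rw [norm_smul, norm_uLp, mul_one])

/-- The closed operator `L` may be applied term by term to an absolutely convergent series of
eigenfunctions if the resulting series converges absolutely as well. -/
theorem tsum_mem_domain {c : ι → ℂ} (hc : Summable fun ξ => ‖c ξ‖)
    (hc' : Summable fun ξ => ‖D.lam ξ * c ξ‖) :
    (∑' ξ, c ξ • D.uLp ξ) ∈ D.L.domain ∧
      applyOp D.L (∑' ξ, c ξ • D.uLp ξ) = ∑' ξ, (D.lam ξ * c ξ) • D.uLp ξ := by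
  have h1 : HasSum _ _ := (D.summable_smul_uLp hc).hasSum
  have h2 : HasSum _ _ := (D.summable_smul_uLp hc').hasSum
  have hmem : ((∑' ξ, c ξ • D.uLp ξ), (∑' ξ, (D.lam ξ * c ξ) • D.uLp ξ)) ∈ D.L.graph := by
    refine D.isClosed.mem_of_tendsto (Tendsto.prodMk_nhds h1 h2) (Eventually.of_forall fun s => ?_)
    have h3 : ((∑ ξ ∈ s, c ξ • D.uLp ξ), (∑ ξ ∈ s, (D.lam ξ * c ξ) • D.uLp ξ)) =
        ∑ ξ ∈ s, c ξ • (D.uLp ξ, D.lam ξ • D.uLp ξ) := by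
      ext1
      · simp [Prod.fst_sum]
      · simp [Prod.snd_sum, smul_smul, mul_comm]
    rw [h3]
    refine Submodule.sum_mem _ fun ξ _ => Submodule.smul_mem _ _ ?_
    exact (LinearPMap.mem_graph_iff _).2 ⟨⟨D.uLp ξ, D.uLp_mem_domain ξ⟩, rfl, by
      rw [← applyOp_of_mem, applyOp_uLp]⟩
  obtain ⟨y, hy, hy'⟩ := (LinearPMap.mem_graph_iff _).1 hmem
  have hd : (∑' ξ, c ξ • D.uLp ξ) ∈ D.L.domain := by
    have := y.2
    rwa [hy] at this
  refine ⟨hd, ?_⟩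
  rw [applyOp_of_mem _ hd]
  exact (congrArg D.L (Subtype.ext hy.symm)).trans hy'

theorem tsum_mem_testSpace {c : ι → ℂ} (hc : ∀ j : ℕ, Summable fun ξ => ‖D.lam ξ ^ j * c ξ‖) :
    (∑' ξ, c ξ • D.uLp ξ) ∈ testSpace D.L := by
  have hc' : ∀ j : ℕ, Summable fun ξ => ‖D.lam ξ * (D.lam ξ ^ j * c ξ)‖ := fun j => by
    simpa only [pow_succ', mul_assoc] using hc (j + 1)
  have key : ∀ j : ℕ, (applyOp D.L)^[j] (∑' ξ, c ξ • D.uLp ξ) =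
      ∑' ξ, (D.lam ξ ^ j * c ξ) • D.uLp ξ := by
    intro j
    induction j with
    | zero => simp
    | succ j ih =>
      rw [Function.iterate_succ_apply', ih, (D.tsum_mem_domain (hc j) (hc' j)).2]
      simp only [pow_succ', mul_assoc]
  intro j
  rw [key]
  exact (D.tsum_mem_domain (hc j) (hc' j)).1

theorem inner_vLp_tsum {c : ι → ℂ} (hc : Summable fun ξ => ‖c ξ‖) (η : ι) :
    (inner ℂ (D.vLp η) (∑' ξ, c ξ • D.uLp ξ) : ℂ) = c η := by
  have h := (D.summable_smul_uLp hc).hasSum.mapL (innerSL ℂ (D.vLp η))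
  refine h.unique ?_
  have h1 : ∀ ξ, innerSL ℂ (D.vLp η) (c ξ • D.uLp ξ) = if ξ = η then c η else 0 := fun ξ => by
    rw [innerSL_apply_apply, inner_smul_right, inner_vLp_uLp]
    split_ifs with h
    · rw [h, mul_one]
    · rw [mul_zero]
  simp only [h1]
  exact hasSum_ite_eq η (c η)

theorem heat_eq (q t : ℝ) (f : Lp ℂ 2 μ) :
    D.heat q t f =
      ∑' ξ, ((Real.exp (-t * D.modulus q ξ) : ℂ) * inner ℂ (D.vLp ξ) f) • D.uLp ξ := by
  simp only [heat, fourier_eq_inner, uLp]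

variable [Nonempty ι]

theorem summable_lam_pow_mul_heat {q t : ℝ} (hq : 0 < q) (ht : 0 < t) (f : Lp ℂ 2 μ) (j : ℕ) :
    Summable fun ξ =>
      ‖D.lam ξ ^ j * ((Real.exp (-t * D.modulus q ξ) : ℂ) * inner ℂ (D.vLp ξ) f)‖ := by
  obtain ⟨C, hC⟩ := D.exists_norm_inner_vLp_le f
  refine Summable.of_nonneg_of_le (fun _ => norm_nonneg _) (fun ξ => ?_)
    ((D.summable_exp_modulus_mul_bracket_rpow hq ht (D.ν * j)).mul_left C)
  have hb := D.bracket_pos ξ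
  rw [norm_mul, norm_mul, norm_pow, Complex.norm_real, Real.norm_of_nonneg (Real.exp_nonneg _),
    Real.rpow_mul hb.le, Real.rpow_natCast]
  calc ‖D.lam ξ‖ ^ j * (Real.exp (-t * D.modulus q ξ) * ‖(inner ℂ (D.vLp ξ) f : ℂ)‖)
      ≤ (D.bracket ξ ^ D.ν) ^ j * (Real.exp (-t * D.modulus q ξ) * C) := by
        gcongr
        · exact D.norm_lam_le_bracket_rpow ξ
        · exact hC ξ
    _ = _ := by ring

theorem heat_mem_testSpace {q t : ℝ} (hq : 0 < q) (ht : 0 < t) (f : Lp ℂ 2 μ) :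
    D.heat q t f ∈ testSpace D.L := by
  rw [heat_eq]
  exact D.tsum_mem_testSpace (D.summable_lam_pow_mul_heat hq ht f)

theorem fourier_heat {q t : ℝ} (hq : 0 < q) (ht : 0 < t) (f : Lp ℂ 2 μ) (ξ : ι) :
    D.fourier (D.heat q t f) ξ =
      (Real.exp (-t * D.modulus q ξ) : ℂ) * inner ℂ (D.vLp ξ) f := by
  rw [fourier_eq_inner, heat_eq, D.inner_vLp_tsum]
  simpa using D.summable_lam_pow_mul_heat hq ht f 0

/-! ### The bilinear pairing and uniqueness of the heat trace -/

theorem integral_mul_eq_inner_star (f φ : Lp ℂ 2 μ) :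
    ∫ x, f x * φ x ∂μ = inner ℂ (star φ) f := by
  rw [L2.inner_def]
  refine integral_congr_ae ?_
  filter_upwards [Lp.coeFn_star φ] with x hx
  rw [RCLike.inner_apply, hx]
  simp

theorem inner_star_star (f g : Lp ℂ 2 μ) :
    (inner ℂ (star f) (star g) : ℂ) = conj (inner ℂ f g : ℂ) := by
  rw [L2.inner_def, L2.inner_def, ← integral_conj]
  refine integral_congr_ae ?_
  filter_upwards [Lp.coeFn_star f, Lp.coeFn_star g] with x hx hy
  rw [RCLike.inner_apply, RCLike.inner_apply, hx, hy]
  simp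

/-- A function in `L²` is determined by its values as an `L`-distribution. -/
theorem eq_of_integral_mul_testSpace_eq {f g : Lp ℂ 2 μ}
    (h : ∀ φ : testSpace (D.L†), ∫ x, f x * (φ : Lp ℂ 2 μ) x ∂μ =
      ∫ x, g x * (φ : Lp ℂ 2 μ) x ∂μ) : f = g := by
  have h1 : star (f - g) = 0 := by
    refine D.eq_zero_of_inner_vLp_eq_zero fun ξ => ?_
    have h2 := h ⟨D.vLp ξ, D.vLp_mem_testSpace ξ⟩
    rw [integral_mul_eq_inner_star, integral_mul_eq_inner_star, ← sub_eq_zero, ← inner_sub_right]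
      at h2
    rw [← star_star (D.vLp ξ), inner_star_star, h2, map_zero]
  have h3 := inner_star_star (f - g) (f - g)
  rw [h1, inner_zero_left, eq_comm, map_eq_zero, inner_self_eq_zero] at h3
  exact sub_eq_zero.1 h3

theorem HasHeatTrace.unique {A : D.Operator} {q t : ℝ} {τ τ' : ℂ} (h : D.HasHeatTrace A q t τ)
    (h' : D.HasHeatTrace A q t τ') : τ = τ' := by
  obtain ⟨T, hT, hτ⟩ := h
  obtain ⟨T', hT', hτ'⟩ := h'
  have hTT : T = T' := by
    refine ContinuousLinearMap.ext fun f => D.eq_of_integral_mul_testSpace_eq fun φ => ?_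
    obtain ⟨h1, h2⟩ := hT f
    obtain ⟨h3, h4⟩ := hT' f
    rw [← h2, ← h4]
  subst hTT
  exact hτ.unique hτ'

/-! ### The heat trace of an operator with bounded symbol -/

/-- If the functions `σ(·, ξ) u ξ` are represented by `w ξ ∈ L²` with `‖w ξ‖ ≤ B ⟨ξ⟩^m`, then
`A e^{-t M_q}` is the nuclear sum of the operators `e^{-t M_q(ξ)} (·, v ξ) w ξ`. -/
theorem hasHeatTrace_of_norm_le {A : D.Operator} {σ : M → ι → ℂ} (hA : D.HasSymbol A σ)
    {w : ι → Lp ℂ 2 μ} (hw : ∀ ξ, w ξ =ᵐ[μ] fun x => D.u ξ x * σ x ξ) {B m : ℝ}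
    (hB : ∀ ξ, ‖w ξ‖ ≤ B * D.bracket ξ ^ m) {q t : ℝ} (hq : 0 < q) (ht : 0 < t) :
    D.HasHeatTrace A q t
      (∑' ξ, (Real.exp (-t * D.modulus q ξ) : ℂ) * inner ℂ (D.vLp ξ) (w ξ)) := by
  obtain ⟨K, hK0, hK⟩ := D.exists_norm_vLp_le
  have : Countable ι := countable_index ι
  have hs : Summable fun ξ => ‖(Real.exp (-t * D.modulus q ξ) : ℂ) • w ξ‖ * ‖D.vLp ξ‖ := by
    refine Summable.of_nonneg_of_le (fun ξ => by positivity) (fun ξ => ?_)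
      ((D.summable_exp_modulus_mul_bracket_rpow hq ht m).mul_left (B * K))
    have := (norm_nonneg _).trans (hB ξ)
    rw [norm_smul, Complex.norm_real, Real.norm_of_nonneg (Real.exp_nonneg _)]
    calc Real.exp (-t * D.modulus q ξ) * ‖w ξ‖ * ‖D.vLp ξ‖
        ≤ Real.exp (-t * D.modulus q ξ) * (B * D.bracket ξ ^ m) * K := by
          gcongr
          · exact hB ξ
          · exact hK ξ
      _ = _ := by ring
  obtain ⟨T, hT⟩ := exists_nuclear _ _ hs
  refine ⟨T, fun f => ⟨D.heat_mem_testSpace hq ht f, fun φ => ?_⟩, ?_⟩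
  · have h1 := hA ⟨D.heat q t f, D.heat_mem_testSpace hq ht f⟩ φ
    have h2 := (hT f).mapL (innerSL ℂ (star (φ : Lp ℂ 2 μ)))
    rw [integral_mul_eq_inner_star]
    refine h1.unique (h2.congr_fun fun ξ => ?_)
    have h3 : ∫ x, (D.u ξ x * σ x ξ) * (φ : Lp ℂ 2 μ) x ∂μ =
        inner ℂ (star (φ : Lp ℂ 2 μ)) (w ξ) := by
      rw [← integral_mul_eq_inner_star]
      refine integral_congr_ae ?_
      filter_upwards [hw ξ] with x hx
      rw [hx]
    rw [h3, D.fourier_heat hq ht]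
    simp only [innerSL_apply_apply, inner_smul_right]
    ring
  · have h4 := hasTrace_of_nuclear T _ _ hs hT
    simpa only [inner_smul_right] using h4

end ModelOperator

/-! ### Operators with symbols in the symbol classes -/

section Symbol

variable {n : ℕ} [NeZero n] {M : Type*} [TopologicalSpace M]
  [ChartedSpace (EuclideanHalfSpace n) M] [MeasurableSpace M] {μ : Measure M}
  {ι : Type*} [LinearOrder ι] [LocallyFiniteOrderBot ι] {D : ModelOperator μ ι} {m : ℝ}

theorem PseudoOperator.seminorm_nonneg (P : PseudoOperator n D m) : 0 ≤ P.seminorm :=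
  Real.iSup_nonneg fun p => by
    have := D.bracket_pos p.2
    positivity

/-- The symbol estimate without differences and derivatives. -/
theorem PseudoOperator.norm_symbol_le (P : PseudoOperator n D m) (x : M) (ξ : ι) :
    ‖P.σ x ξ‖ ≤ P.seminorm * D.bracket ξ ^ m := by
  have hb : ∀ ξ, 0 < D.bracket ξ ^ m := fun ξ => Real.rpow_pos_of_pos (D.bracket_pos ξ) m
  obtain ⟨C, hC⟩ := (P.σ_mem.2 0 0).2
  have hbdd : BddAbove (Set.range fun p : M × ι => ‖P.σ p.1 p.2‖ / D.bracket p.2 ^ m) := by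
    refine ⟨C, ?_⟩
    rintro _ ⟨⟨x, ξ⟩, rfl⟩
    have h := hC x ξ
    simp only [AdmissibleCollection.diffOp, AdmissibleCollection.DopSymbol, if_true,
      P.S.Dop_zero, Pi.zero_apply, Finset.sum_const_zero, Nat.cast_zero, mul_zero, sub_zero,
      add_zero] at h
    exact (div_le_iff₀ (hb ξ)).2 h
  exact (div_le_iff₀ (hb ξ)).1 (le_ciSup hbdd (x, ξ))

variable [BorelSpace M] [Nonempty ι]

/-- The heat trace exists, and it is dominated by the heat sum of the order of the symbol. -/
theorem exists_heatTrace_norm_le (D : ModelOperator μ ι) (m : ℝ) :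
    ∃ K : ℝ, 0 < K ∧ ∀ (P : PseudoOperator n D m) (q t : ℝ), 0 < q → 0 < t →
      ∃ τ, D.HasHeatTrace P.A q t τ ∧
        ‖τ‖ ≤ K * P.seminorm * ∑' ξ, Real.exp (-t * D.modulus q ξ) * D.bracket ξ ^ m := by
  obtain ⟨K, hK0, hK⟩ := D.exists_norm_vLp_le
  refine ⟨K, hK0, fun P q t hq ht => ?_⟩
  have hbound : ∀ ξ x, ‖D.u ξ x * P.σ x ξ‖ ≤ (P.seminorm * D.bracket ξ ^ m) * ‖D.u ξ x‖ :=
    fun ξ x => by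
      rw [norm_mul, mul_comm]
      gcongr
      exact P.norm_symbol_le x ξ
  have hmem : ∀ ξ, MemLp (fun x => D.u ξ x * P.σ x ξ) 2 μ := fun ξ =>
    (D.memLp_u ξ).of_le_mul
      ((D.memLp_u ξ).1.mul (P.σ_mem.1 ξ).continuous.measurable.aestronglyMeasurable)
      (Eventually.of_forall (hbound ξ))
  have hnorm : ∀ ξ, ‖(hmem ξ).toLp‖ ≤ P.seminorm * D.bracket ξ ^ m := fun ξ => by
    have h := Lp.norm_le_mul_norm_of_ae_le_mul (f := (hmem ξ).toLp) (g := D.uLp ξ)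
      (c := P.seminorm * D.bracket ξ ^ m) (by
        filter_upwards [(hmem ξ).coeFn_toLp, (D.memLp_u ξ).coeFn_toLp] with x hx hy
        rw [hx, ModelOperator.uLp, hy]
        exact hbound ξ x)
    rwa [D.norm_uLp, mul_one] at h
  refine ⟨_, D.hasHeatTrace_of_norm_le P.hasSymbol (fun ξ => (hmem ξ).coeFn_toLp) hnorm hq ht, ?_⟩
  refine tsum_of_norm_bounded
    ((D.summable_exp_modulus_mul_bracket_rpow hq ht m).hasSum.mul_left _) fun ξ => ?_
  have hs := P.seminorm_nonneg
  have hb := D.bracket_pos ξ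
  rw [norm_mul, Complex.norm_real, Real.norm_of_nonneg (Real.exp_nonneg _)]
  calc Real.exp (-t * D.modulus q ξ) * ‖(inner ℂ (D.vLp ξ) (hmem ξ).toLp : ℂ)‖
      ≤ Real.exp (-t * D.modulus q ξ) * (K * (P.seminorm * D.bracket ξ ^ m)) := by
        gcongr
        exact (norm_inner_le_norm _ _).trans (mul_le_mul (hK ξ) (hnorm ξ) (norm_nonneg _) hK0.le)
    _ = _ := by ring

end Symbol

end NonharmonicTrace

namespace NonharmonicTrace

/-! ### The integral `∫₁^∞ e^{-t r^q} r^p dr` -/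

theorem rpow_mul_rpow_neg_abs_le {κ b r : ℝ} (hκ : 1 ≤ κ) (hb : 0 < b) (h1 : b / κ ≤ r)
    (h2 : r ≤ b) (p : ℝ) : κ ^ (-|p|) * b ^ p ≤ r ^ p := by
  have hκ0 : 0 < κ := by linarith
  have hr : 0 < r := (by positivity : 0 < b / κ).trans_le h1
  rcases le_total 0 p with hp | hp
  · calc κ ^ (-|p|) * b ^ p = (b / κ) ^ p := by
          rw [abs_of_nonneg hp, Real.div_rpow hb.le hκ0.le, Real.rpow_neg hκ0.le,
            inv_mul_eq_div]
      _ ≤ r ^ p := Real.rpow_le_rpow (by positivity) h1 hp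
  · calc κ ^ (-|p|) * b ^ p ≤ 1 * b ^ p := by
          gcongr
          exact Real.rpow_le_one_of_one_le_of_nonpos hκ (by simp)
      _ ≤ r ^ p := by
          rw [one_mul]
          exact Real.rpow_le_rpow_of_nonpos hr h2 hp

theorem integrableOn_exp_neg_mul_rpow_mul_rpow {q t a : ℝ} (hq : 0 < q) (ht : 0 < t) (ha : 0 < a)
    (p : ℝ) : IntegrableOn (fun r : ℝ => Real.exp (-t * r ^ q) * r ^ p) (Set.Ioi a) := by
  have h1 : IntegrableOn (fun r : ℝ => r ^ |p| * Real.exp (-t * r ^ q)) (Set.Ioi a) :=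
    (integrableOn_rpow_mul_exp_neg_mul_rpow (by linarith [abs_nonneg p]) hq ht).mono_set
      (Set.Ioi_subset_Ioi ha.le)
  refine Integrable.mono' (h1.const_mul (a ^ p * a ^ (-|p|)))
    (Measurable.aestronglyMeasurable (by fun_prop)) ?_
  refine (ae_restrict_iff' measurableSet_Ioi).2 (Eventually.of_forall fun r hr => ?_)
  have hr : a < r := hr
  have hr0 : 0 < r := ha.trans hr
  have h2 : r ^ p ≤ a ^ p * a ^ (-|p|) * r ^ |p| := by
    have h3 : (r / a) ^ p ≤ (r / a) ^ |p| :=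
      Real.rpow_le_rpow_of_exponent_le ((one_le_div ha).2 hr.le) (le_abs_self p)
    rw [Real.div_rpow hr0.le ha.le, Real.div_rpow hr0.le ha.le, div_le_iff₀ (by positivity)] at h3
    rw [Real.rpow_neg ha.le]
    calc r ^ p ≤ _ := h3
      _ = _ := by ring
  rw [Real.norm_of_nonneg (by positivity)]
  calc Real.exp (-t * r ^ q) * r ^ p
      ≤ Real.exp (-t * r ^ q) * (a ^ p * a ^ (-|p|) * r ^ |p|) := by gcongr
    _ = _ := by ring

/-- The substitution `s = t^{1/q} r`. -/
theorem heatBound_eq_integral {q t : ℝ} (hq : 0 < q) (ht : 0 < t) (Q m : ℝ) :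
    heatBound Q m q t = ∫ r in Set.Ioi (1 : ℝ), Real.exp (-t * r ^ q) * r ^ (Q + m - 1) := by
  have hb : 0 < t ^ (1 / q) := by positivity
  have h := integral_comp_mul_left_Ioi (fun s => Real.exp (-(s ^ q)) * s ^ (Q + m - 1)) 1 hb
  rw [mul_one, smul_eq_mul] at h
  have h2 : ∀ r ∈ Set.Ioi (1 : ℝ), Real.exp (-((t ^ (1 / q) * r) ^ q)) *
      (t ^ (1 / q) * r) ^ (Q + m - 1) =
      t ^ ((Q + m - 1) / q) * (Real.exp (-t * r ^ q) * r ^ (Q + m - 1)) := by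
    intro r hr
    have hr0 : 0 < r := lt_trans one_pos hr
    rw [Real.mul_rpow hb.le hr0.le, Real.mul_rpow hb.le hr0.le, ← Real.rpow_mul ht.le,
      ← Real.rpow_mul ht.le, one_div_mul_cancel hq.ne', Real.rpow_one, neg_mul]
    ring_nf
  rw [setIntegral_congr_fun measurableSet_Ioi h2, integral_const_mul, eq_inv_mul_iff_mul_eq₀ hb.ne']
    at h
  rw [heatBound, ← h, ← mul_assoc, ← mul_assoc, ← Real.rpow_add ht, ← Real.rpow_add ht]
  rw [show -((Q + m) / q) + 1 / q + (Q + m - 1) / q = 0 by field_simp; ring, Real.rpow_zero,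
    one_mul]

theorem heatBound_nonneg {q t : ℝ} (hq : 0 < q) (ht : 0 < t) (Q m : ℝ) :
    0 ≤ heatBound Q m q t := by
  rw [heatBound_eq_integral hq ht]
  refine setIntegral_nonneg measurableSet_Ioi fun r hr => ?_
  have : 0 < r := lt_trans one_pos hr
  positivity

/-- On an interval of length comparable to `1 / (1 + t)` to the right of `1` the exponent `t r^q`
exceeds `t` by a bounded amount only. -/
theorem exists_exp_neg_le_integral {q : ℝ} (hq : 0 < q) (p : ℝ) :
    ∃ c : ℝ, 0 < c ∧ ∀ t : ℝ, 0 < t →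
      Real.exp (-t) ≤ c * (1 + t) * ∫ r in Set.Ioi (1 : ℝ), Real.exp (-t * r ^ q) * r ^ p := by
  set d : ℝ := Real.exp (-(q * Real.exp q)) * ((2 : ℝ) ^ (-|p|) * 2 ^ p) with hd
  have hd0 : 0 < d := by positivity
  refine ⟨d⁻¹, by positivity, fun t ht => ?_⟩
  set ε : ℝ := 1 / (1 + t) with hε
  have hε0 : 0 < ε := by positivity
  have hε1 : ε ≤ 1 := (div_le_one (by positivity)).2 (by linarith)
  have htε : t * ε ≤ 1 := by
    rw [hε, mul_one_div]
    exact (div_le_one (by positivity)).2 (by linarith)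
  have hint := integrableOn_exp_neg_mul_rpow_mul_rpow hq ht one_pos p
  have hsub : Set.Ioc 1 (1 + ε) ⊆ Set.Ioi (1 : ℝ) := fun r hr => hr.1
  have hpt : ∀ r ∈ Set.Ioc 1 (1 + ε), Real.exp (-t) * d ≤ Real.exp (-t * r ^ q) * r ^ p := by
    intro r hr
    have hr0 : 0 < r := one_pos.trans hr.1
    have h1 : r ^ q ≤ 1 + q * ε * Real.exp q := by
      have hlog : Real.log r ≤ ε := by linarith [Real.log_le_sub_one_of_pos hr0, hr.2]
      have h2 : r ^ q ≤ Real.exp (q * ε) := by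
        rw [Real.rpow_def_of_pos hr0, mul_comm]
        gcongr
      -- `e^y ≤ 1 + y e^y` for `y = q ε`
      have h3 : Real.exp (q * ε) ≤ 1 + q * ε * Real.exp (q * ε) := by
        have h4 := Real.add_one_le_exp (-(q * ε))
        rw [Real.exp_neg, ← one_div, le_div_iff₀ (Real.exp_pos _)] at h4
        linarith
      have h5 : Real.exp (q * ε) ≤ Real.exp q := by
        gcongr
        nlinarith
      calc r ^ q ≤ 1 + q * ε * Real.exp (q * ε) := h2.trans h3
        _ ≤ 1 + q * ε * Real.exp q := by gcongr
    have h6 : t * r ^ q ≤ t + q * Real.exp q := by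
      calc t * r ^ q ≤ t * (1 + q * ε * Real.exp q) := by gcongr
        _ = t + (t * ε) * (q * Real.exp q) := by ring
        _ ≤ t + 1 * (q * Real.exp q) := by gcongr
        _ = _ := by ring
    rw [hd, ← mul_assoc, ← Real.exp_add]
    gcongr
    · linarith
    · exact rpow_mul_rpow_neg_abs_le one_le_two two_pos (by linarith [hr.1]) (by linarith [hr.2]) p
  have h7 := setIntegral_ge_of_const_le_real measurableSet_Ioc (by simp) hpt (hint.mono_set hsub)
  have h8 := setIntegral_mono_set hint
    ((ae_restrict_iff' measurableSet_Ioi).2 (Eventually.of_forall fun r hr => by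
      have : 0 < r := lt_trans one_pos hr
      simp only [Pi.zero_apply]
      positivity)) hsub.eventuallyLE
  have h9 := h7.trans h8
  rw [Real.volume_real_Ioc_of_le (by linarith), add_sub_cancel_left] at h9
  calc Real.exp (-t) = d⁻¹ * (1 + t) * (Real.exp (-t) * d * ε) := by
        rw [hε]
        field_simp
    _ ≤ _ := by gcongr

/-- The value at `b` is dominated by the integral over `(b / κ, b]`. -/
theorem exists_exp_mul_rpow_le_setIntegral {q : ℝ} (hq : 0 < q) (m : ℝ) {κ : ℝ} (hκ : 1 < κ) :
    ∃ c : ℝ, 0 < c ∧ ∀ t : ℝ, 0 < t → ∀ b : ℝ, 0 < b →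
      Real.exp (-t * b ^ q) * b ^ m ≤
        c * ∫ r in Set.Ioc (b / κ) b, Real.exp (-t * r ^ q) * r ^ (m - 1) := by
  have hκ0 : 0 < κ := by linarith
  have hκ1 : 0 < 1 - 1 / κ := by
    rw [sub_pos]
    exact (div_lt_one hκ0).2 hκ
  refine ⟨(κ ^ (-|m - 1|) * (1 - 1 / κ))⁻¹, by positivity, fun t ht b hb => ?_⟩
  have hbκ : 0 < b / κ := by positivity
  have hint : IntegrableOn (fun r : ℝ => Real.exp (-t * r ^ q) * r ^ (m - 1))
      (Set.Ioc (b / κ) b) :=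
    (integrableOn_exp_neg_mul_rpow_mul_rpow hq ht hbκ (m - 1)).mono_set fun r hr => hr.1
  have h := setIntegral_ge_of_const_le_real
    (c := Real.exp (-t * b ^ q) * (κ ^ (-|m - 1|) * b ^ (m - 1))) measurableSet_Ioc (by simp)
    (fun r hr => by
      have hr0 : 0 < r := hbκ.trans hr.1
      gcongr ?_ * ?_
      · refine Real.exp_le_exp.2 ?_
        have := Real.rpow_le_rpow hr0.le hr.2 hq.le
        nlinarith
      · exact rpow_mul_rpow_neg_abs_le hκ.le hb hr.1.le hr.2 _) hint
  rw [Real.volume_real_Ioc_of_le (div_le_self hb.le hκ.le)] at h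
  rw [inv_mul_eq_div, le_div_iff₀ (by positivity)]
  refine le_trans (le_of_eq ?_) h
  rw [Real.rpow_sub_one hb.ne']
  field_simp

/-! ### The heat sum -/

namespace ModelOperator

variable {M : Type*} [MeasurableSpace M] {μ : Measure M}
  {ι : Type*} [LinearOrder ι] [LocallyFiniteOrderBot ι] (D : ModelOperator μ ι)

theorem finite_bracket_le (r : ℝ) : {ξ : ι | D.bracket ξ ≤ r}.Finite := by
  have h := (D.summable_exp_modulus_mul_bracket_rpow one_pos one_pos 0).tendsto_cofinite_zero
  have h1 := h.eventually (eventually_lt_nhds (Real.exp_pos (-r)))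
  refine Set.Finite.subset h1 fun ξ hξ hlt => ?_
  have hξ : D.bracket ξ ≤ r := hξ
  change Real.exp (-1 * D.modulus 1 ξ) * D.bracket ξ ^ (0 : ℝ) < Real.exp (-r) at hlt
  rw [modulus_eq_bracket_rpow, Real.rpow_one, Real.rpow_zero, mul_one, Real.exp_lt_exp] at hlt
  linarith

theorem card_filter_le_counting (F : Finset ι) {p : ι → Prop} [DecidablePred p] {r : ℝ}
    (hp : ∀ ξ ∈ F, p ξ → D.bracket ξ ≤ r) : (F.filter p).card ≤ D.counting r := by
  have : Finite {ξ : ι // D.bracket ξ ≤ r} := D.finite_bracket_le r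
  rw [counting, ← Nat.card_eq_finsetCard]
  refine Nat.card_le_card_of_injective
    (fun ξ : (F.filter p) => (⟨ξ, ?_⟩ : {ξ : ι // D.bracket ξ ≤ r})) fun a b hab => ?_
  · exact hp ξ (Finset.mem_filter.1 ξ.2).1 (Finset.mem_filter.1 ξ.2).2
  · exact Subtype.ext (congrArg (fun z : {ξ : ι // D.bracket ξ ≤ r} => (z : ι)) hab)

theorem counting_mono : Monotone D.counting := fun r s hrs => by
  have : Finite {ξ : ι // D.bracket ξ ≤ s} := D.finite_bracket_le s
  exact Nat.card_mono (D.finite_bracket_le s) fun ξ (hξ : D.bracket ξ ≤ r) => hξ.trans hrs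

theorem WeylLaw.exists_counting_le {D : ModelOperator μ ι} {Q : ℝ} (hQ : 0 < Q)
    (hW : D.WeylLaw Q) : ∃ C : ℝ, 0 < C ∧ ∀ r : ℝ, 1 ≤ r → (D.counting r : ℝ) ≤ C * r ^ Q := by
  obtain ⟨c, hc, h⟩ := hW.exists_pos
  obtain ⟨R, hR⟩ := eventually_atTop.1 h.bound
  refine ⟨c + D.counting R, by positivity, fun r hr => ?_⟩
  have hrQ : 1 ≤ r ^ Q := Real.one_le_rpow hr hQ.le
  rcases le_total R r with h1 | h1
  · have h2 := hR r h1
    rw [Real.norm_of_nonneg (by positivity), Real.norm_of_nonneg (by positivity)] at h2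
    refine h2.trans ?_
    gcongr
    simp
  · have h2 : (D.counting r : ℝ) ≤ D.counting R := by exact_mod_cast D.counting_mono h1
    nlinarith

/-- The part of the heat sum over `⟨ξ⟩ ≥ κ > 1`: each term is dominated by the integral over
`(⟨ξ⟩ / κ, ⟨ξ⟩]`, and `r` lies in at most `N(κ r)` of these intervals. -/
theorem exists_sum_le_heatBound {Q : ℝ} (hQ : 0 < Q) (hW : D.WeylLaw Q) (m : ℝ) {q : ℝ}
    (hq : 0 < q) {κ : ℝ} (hκ : 1 < κ) :
    ∃ c : ℝ, 0 < c ∧ ∀ t : ℝ, 0 < t → ∀ F : Finset ι, (∀ ξ ∈ F, κ ≤ D.bracket ξ) →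
      ∑ ξ ∈ F, Real.exp (-t * D.modulus q ξ) * D.bracket ξ ^ m ≤ c * heatBound Q m q t := by
  have hκ0 : 0 < κ := by linarith
  obtain ⟨c₁, hc₁, h₁⟩ := exists_exp_mul_rpow_le_setIntegral hq m hκ
  obtain ⟨C, hC, hN⟩ := hW.exists_counting_le hQ
  refine ⟨c₁ * (C * κ ^ Q), by positivity, fun t ht F hF => ?_⟩
  set g : ℝ → ℝ := fun r => Real.exp (-t * r ^ q) * r ^ (m - 1) with hg
  have hgint : IntegrableOn g (Set.Ioi 1) :=
    integrableOn_exp_neg_mul_rpow_mul_rpow hq ht one_pos (m - 1)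
  set I : ι → Set ℝ := fun ξ => Set.Ioc (D.bracket ξ / κ) (D.bracket ξ) with hI
  have hterm : ∀ ξ ∈ F, Real.exp (-t * D.modulus q ξ) * D.bracket ξ ^ m ≤
      c₁ * ∫ r in Set.Ioi (1 : ℝ), (I ξ).indicator g r := by
    intro ξ hξ
    rw [modulus_eq_bracket_rpow, setIntegral_indicator measurableSet_Ioc,
      Set.inter_eq_self_of_subset_right]
    · exact h₁ t ht _ (D.bracket_pos ξ)
    · exact fun r hr => ((one_le_div hκ0).2 (hF ξ hξ)).trans_lt hr.1
  have hind : ∀ ξ ∈ F, Integrable ((I ξ).indicator g) (volume.restrict (Set.Ioi 1)) :=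
    fun ξ _ => hgint.indicator measurableSet_Ioc
  have hpt : ∀ r ∈ Set.Ioi (1 : ℝ), ∑ ξ ∈ F, (I ξ).indicator g r ≤
      (C * κ ^ Q) * (Real.exp (-t * r ^ q) * r ^ (Q + m - 1)) := by
    classical
    intro r hr
    have hr1 : 1 < r := hr
    have hr0 : 0 < r := lt_trans one_pos hr
    have hcount : ((F.filter fun ξ => r ∈ I ξ).card : ℝ) ≤ C * (κ * r) ^ Q := by
      refine le_trans ?_ (hN (κ * r) (by nlinarith))
      refine Nat.cast_le.2 (D.card_filter_le_counting F fun ξ _ hξ => ?_)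
      have := (div_lt_iff₀ hκ0).1 hξ.1
      linarith
    rw [Finset.sum_indicator_eq_sum_filter F (fun _ => g) I (fun _ => r), Finset.sum_const,
      nsmul_eq_mul]
    calc ((F.filter fun ξ => r ∈ I ξ).card : ℝ) * g r ≤ C * (κ * r) ^ Q * g r := by
          gcongr
      _ = _ := by
          rw [hg, Real.mul_rpow hκ0.le hr0.le, show Q + m - 1 = Q + (m - 1) by ring,
            Real.rpow_add hr0]
          ring
  calc ∑ ξ ∈ F, Real.exp (-t * D.modulus q ξ) * D.bracket ξ ^ m
      ≤ ∑ ξ ∈ F, c₁ * ∫ r in Set.Ioi (1 : ℝ), (I ξ).indicator g r := Finset.sum_le_sum hterm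
    _ = c₁ * ∫ r in Set.Ioi (1 : ℝ), ∑ ξ ∈ F, (I ξ).indicator g r := by
        rw [← Finset.mul_sum, integral_finsetSum F hind]
    _ ≤ c₁ * ∫ r in Set.Ioi (1 : ℝ),
          (C * κ ^ Q) * (Real.exp (-t * r ^ q) * r ^ (Q + m - 1)) := by
        refine mul_le_mul_of_nonneg_left ?_ hc₁.le
        exact setIntegral_mono_on (integrable_finsetSum F hind)
          ((integrableOn_exp_neg_mul_rpow_mul_rpow hq ht one_pos _).const_mul _)
          measurableSet_Ioi hpt
    _ = _ := by rw [integral_const_mul, heatBound_eq_integral hq ht, ← mul_assoc]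

theorem exists_tsum_le_heatBound {Q : ℝ} (hQ : 0 < Q) (hW : D.WeylLaw Q) (m : ℝ) {q : ℝ}
    (hq : 0 < q) :
    ∃ c : ℝ, 0 < c ∧ ∀ t : ℝ, 0 < t →
      ∑' ξ, Real.exp (-t * D.modulus q ξ) * D.bracket ξ ^ m ≤
        c * (1 + t) * heatBound Q m q t := by
  obtain ⟨c₁, hc₁, h₁⟩ := D.exists_sum_le_heatBound hQ hW m hq one_lt_two
  obtain ⟨c₂, hc₂, h₂⟩ := exists_exp_neg_le_integral hq (Q + m - 1)
  refine ⟨c₁ + D.counting 2 * (2 ^ |m| * c₂), by positivity, fun t ht => ?_⟩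
  have hH := heatBound_nonneg hq ht Q m
  refine (D.summable_exp_modulus_mul_bracket_rpow hq ht m).tsum_le_of_sum_le fun F => ?_
  rw [← Finset.sum_filter_add_sum_filter_not F (fun ξ => 2 ≤ D.bracket ξ)]
  have hlarge := h₁ t ht (F.filter fun ξ => 2 ≤ D.bracket ξ) fun ξ hξ => (Finset.mem_filter.1 hξ).2
  have hsmall : ∑ ξ ∈ F.filter (fun ξ => ¬ 2 ≤ D.bracket ξ),
      Real.exp (-t * D.modulus q ξ) * D.bracket ξ ^ m ≤
      D.counting 2 * (2 ^ |m| * Real.exp (-t)) := by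
    calc _ ≤ ∑ ξ ∈ F.filter (fun ξ => ¬ 2 ≤ D.bracket ξ), (2 : ℝ) ^ |m| * Real.exp (-t) := by
          refine Finset.sum_le_sum fun ξ hξ => ?_
          have hξ2 : D.bracket ξ < 2 := not_le.1 (Finset.mem_filter.1 hξ).2
          have hb1 := D.one_le_bracket ξ
          rw [mul_comm, modulus_eq_bracket_rpow]
          gcongr ?_ * ?_
          · exact (Real.rpow_le_rpow_of_exponent_le hb1 (le_abs_self m)).trans
              (Real.rpow_le_rpow (by linarith) hξ2.le (abs_nonneg m))
          · have := Real.one_le_rpow hb1 hq.le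
            exact Real.exp_le_exp.2 (by nlinarith)
      _ ≤ _ := by
          rw [Finset.sum_const, nsmul_eq_mul]
          gcongr
          exact D.card_filter_le_counting F fun ξ _ hξ => (not_le.1 hξ).le
  have h3 := h₂ t ht
  rw [← heatBound_eq_integral hq ht] at h3
  calc _ ≤ c₁ * heatBound Q m q t + D.counting 2 * (2 ^ |m| * Real.exp (-t)) :=
        add_le_add hlarge hsmall
    _ ≤ c₁ * (1 + t) * heatBound Q m q t +
          D.counting 2 * (2 ^ |m| * (c₂ * (1 + t) * heatBound Q m q t)) := by
        gcongr
        exact le_mul_of_one_le_right hc₁.le (by linarith)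
    _ = _ := by ring

theorem exists_one_lt_le_bracket [Nonempty ι] (h0 : ∀ ξ, D.lam ξ ≠ 0) :
    ∃ κ : ℝ, 1 < κ ∧ ∀ ξ, κ ≤ D.bracket ξ := by
  have hν := D.ν_pos
  obtain ⟨ξ₀⟩ := ‹Nonempty ι›
  obtain ⟨η, -, hη⟩ := (Finset.Iic ξ₀).exists_min_image (fun ξ => ‖D.lam ξ‖)
    ⟨ξ₀, Finset.mem_Iic.2 le_rfl⟩
  have hmin : ∀ ξ, ‖D.lam η‖ ≤ ‖D.lam ξ‖ := fun ξ => by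
    rcases le_total ξ ξ₀ with h | h
    · exact hη ξ (Finset.mem_Iic.2 h)
    · exact (hη ξ₀ (Finset.mem_Iic.2 le_rfl)).trans (D.norm_lam_mono h)
  refine ⟨D.bracket η, ?_, fun ξ => ?_⟩
  · have := norm_pos_iff.2 (h0 η)
    exact Real.one_lt_rpow (by nlinarith) (by positivity)
  · have := hmin ξ
    unfold bracket
    gcongr

theorem exists_tsum_le_heatBound_of_lam_ne_zero [Nonempty ι] {Q : ℝ} (hQ : 0 < Q)
    (hW : D.WeylLaw Q) (m : ℝ) {q : ℝ} (hq : 0 < q) (h0 : ∀ ξ, D.lam ξ ≠ 0) :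
    ∃ c : ℝ, 0 < c ∧ ∀ t : ℝ, 0 < t →
      ∑' ξ, Real.exp (-t * D.modulus q ξ) * D.bracket ξ ^ m ≤ c * heatBound Q m q t := by
  obtain ⟨κ, hκ, hκb⟩ := D.exists_one_lt_le_bracket h0
  obtain ⟨c, hc, h⟩ := D.exists_sum_le_heatBound hQ hW m hq hκ
  exact ⟨c, hc, fun t ht => (D.summable_exp_modulus_mul_bracket_rpow hq ht m).tsum_le_of_sum_le
    fun F => h t ht F fun ξ _ => hκb ξ⟩

end ModelOperator

/-! ### Small times -/

/-- For `m = -Q` the integral in `heatBound` diverges logarithmically at `0`. -/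
theorem exists_heatBound_neg_le_log {q : ℝ} (hq : 0 < q) (Q : ℝ) {t₀ : ℝ} (ht₀ : 0 < t₀)
    (ht₁ : t₀ < 1) :
    ∃ c : ℝ, 0 < c ∧ ∀ t : ℝ, 0 < t → t ≤ t₀ →
      heatBound Q (-Q) q t ≤ c * (-(1 / q * Real.log t)) := by
  have hint : ∀ a : ℝ, 0 < a →
      IntegrableOn (fun s : ℝ => Real.exp (-(s ^ q)) * s ^ (-1 : ℝ)) (Set.Ioi a) := fun a ha => by
    simpa using integrableOn_exp_neg_mul_rpow_mul_rpow hq one_pos ha (-1)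
  set J : ℝ := ∫ s in Set.Ioi (1 : ℝ), Real.exp (-(s ^ q)) * s ^ (-1 : ℝ) with hJ
  have hJ0 : 0 ≤ J := setIntegral_nonneg measurableSet_Ioi fun s hs => by
    have : 0 < s := lt_trans one_pos hs
    positivity
  have hl₀ : 0 < -(1 / q * Real.log t₀) := by
    have := Real.log_neg ht₀ ht₁
    rw [← mul_neg]
    exact mul_pos (by positivity) (by linarith)
  refine ⟨1 + J / -(1 / q * Real.log t₀), by positivity, fun t ht htt => ?_⟩
  have hl : -(1 / q * Real.log t₀) ≤ -(1 / q * Real.log t) := by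
    have := Real.log_le_log ht htt
    gcongr
  set a : ℝ := t ^ (1 / q) with ha
  have ha0 : 0 < a := by positivity
  have ha1 : a ≤ 1 := Real.rpow_le_one ht.le (htt.trans ht₁.le) (by positivity)
  have hsmall : ∫ s in Set.Ioc a 1, Real.exp (-(s ^ q)) * s ^ (-1 : ℝ) ≤
      -(1 / q * Real.log t) := by
    have h1 : ∫ s in Set.Ioc a 1, 1 / s = -(1 / q * Real.log t) := by
      rw [← intervalIntegral.integral_of_le ha1, integral_one_div_of_pos ha0 one_pos, one_div,
        Real.log_inv, ha, Real.log_rpow ht]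
    rw [← h1]
    refine setIntegral_mono_on ((hint a ha0).mono_set fun s hs => hs.1) ?_ measurableSet_Ioc
      fun s hs => ?_
    · refine (ContinuousOn.integrableOn_Icc ?_).mono_set Set.Ioc_subset_Icc_self
      exact continuousOn_const.div continuousOn_id fun s hs => (ha0.trans_le hs.1).ne'
    · have hs0 : 0 < s := ha0.trans hs.1
      rw [Real.rpow_neg_one, ← one_div]
      refine mul_le_of_le_one_left (by positivity) (Real.exp_le_one_iff.2 ?_)
      have : 0 < s ^ q := by positivity
      linarith
  have hsplit : heatBound Q (-Q) q t =
      (∫ s in Set.Ioc a 1, Real.exp (-(s ^ q)) * s ^ (-1 : ℝ)) + J := by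
    rw [heatBound, add_neg_cancel, zero_div, neg_zero, Real.rpow_zero, one_mul, zero_sub,
      ← Set.Ioc_union_Ioi_eq_Ioi ha1]
    exact setIntegral_union (Set.Ioc_disjoint_Ioi le_rfl) measurableSet_Ioi
      ((hint a ha0).mono_set fun s hs => hs.1) (hint 1 one_pos)
  rw [hsplit, add_mul, one_mul]
  gcongr
  rw [div_mul_eq_mul_div, le_div_iff₀ hl₀]
  gcongr

/-- For `m > -Q` the integral in `heatBound` converges at `0`. -/
theorem heatBound_le_rpow_mul_integral {q Q m t : ℝ} (hq : 0 < q) (hm : -Q < m) (ht : 0 < t) :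
    heatBound Q m q t ≤ t ^ (-((Q + m) / q)) *
      ∫ s in Set.Ioi (0 : ℝ), Real.exp (-(s ^ q)) * s ^ (Q + m - 1) := by
  have hint : IntegrableOn (fun s : ℝ => Real.exp (-(s ^ q)) * s ^ (Q + m - 1)) (Set.Ioi 0) := by
    simpa [mul_comm] using
      integrableOn_rpow_mul_exp_neg_mul_rpow (s := Q + m - 1) (by linarith) hq one_pos
  refine mul_le_mul_of_nonneg_left ?_ (by positivity)
  refine setIntegral_mono_set hint ((ae_restrict_iff' measurableSet_Ioi).2
    (Eventually.of_forall fun s hs => ?_))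
    (Set.Ioi_subset_Ioi (by positivity : (0 : ℝ) ≤ t ^ (1 / q))).eventuallyLE
  have : 0 < s := hs
  simp only [Pi.zero_apply]
  positivity

end NonharmonicTrace

theorem mainTheorem2 {n : ℕ} [NeZero n]
    {M : Type*} [TopologicalSpace M] [T2Space M] [SecondCountableTopology M]
    [ChartedSpace (EuclideanHalfSpace n) M] [IsManifold (𝓡∂ n) ∞ M]
    [MeasurableSpace M] [BorelSpace M]
    (μ : Measure M) (hμ : NonharmonicTrace.IsVolumeMeasure n μ)
    {ι : Type*} [LinearOrder ι] [LocallyFiniteOrderBot ι] [Nonempty ι]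
    (D : NonharmonicTrace.ModelOperator μ ι)
    (Q : ℝ) (hQ : 0 < Q) (hW : D.WeylLaw Q) (m q : ℝ) (hq : 0 < q) :
    -- the trace exists and is unique
    (∀ P : NonharmonicTrace.PseudoOperator n D m, ∀ t : ℝ, 0 < t →
      ∃! τ : ℂ, D.HasHeatTrace P.A q t τ) ∧
    -- the estimate for all `t > 0`
    (∃ c : ℝ, 0 < c ∧ ∀ P : NonharmonicTrace.PseudoOperator n D m, ∀ t : ℝ, 0 < t →
      ∀ τ : ℂ, D.HasHeatTrace P.A q t τ →
        ‖τ‖ ≤ c * P.seminorm * (1 + t) * NonharmonicTrace.heatBound Q m q t) ∧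
    -- without the factor `1 + t` if `0` is not an eigenvalue
    ((∀ ξ, D.lam ξ ≠ 0) →
      ∃ c : ℝ, 0 < c ∧ ∀ P : NonharmonicTrace.PseudoOperator n D m, ∀ t : ℝ, 0 < t →
        ∀ τ : ℂ, D.HasHeatTrace P.A q t τ →
          ‖τ‖ ≤ c * P.seminorm * NonharmonicTrace.heatBound Q m q t) ∧
    -- the case `m = -Q`
    (m = -Q → ∀ t₀ : ℝ, 0 < t₀ → t₀ < 1 →
      ∃ c : ℝ, 0 < c ∧ ∀ P : NonharmonicTrace.PseudoOperator n D m, ∀ t : ℝ, 0 < t → t ≤ t₀ →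
        ∀ τ : ℂ, D.HasHeatTrace P.A q t τ →
          ‖τ‖ ≤ c * P.seminorm * (-(1 / q * Real.log t))) ∧
    -- the case `m > -Q`
    (-Q < m →
      ∃ (C : ℝ) (b : ℕ → ℝ) (t₀ : ℝ), 0 < C ∧ 0 < t₀ ∧
        (∀ t : ℝ, 0 < t → t < t₀ → Summable (fun k : ℕ => b k * t ^ ((k : ℝ) / q))) ∧
        ∀ P : NonharmonicTrace.PseudoOperator n D m, ∀ t : ℝ, 0 < t → t < t₀ →
          ∀ τ : ℂ, D.HasHeatTrace P.A q t τ →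
            ‖τ‖ ≤ C * P.seminorm * t ^ (-((Q + m) / q)) *
              ∑' k : ℕ, b k * t ^ ((k : ℝ) / q)) := by
  obtain ⟨K, hK, htr⟩ := NonharmonicTrace.exists_heatTrace_norm_le (n := n) D m
  have hle : ∀ (P : NonharmonicTrace.PseudoOperator n D m) (t : ℝ), 0 < t → ∀ τ : ℂ,
      D.HasHeatTrace P.A q t τ → ‖τ‖ ≤ K * P.seminorm *
        ∑' ξ, Real.exp (-t * D.modulus q ξ) * D.bracket ξ ^ m := by
    intro P t ht τ hτ
    obtain ⟨τ', hτ', hb⟩ := htr P q t hq ht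
    rwa [NonharmonicTrace.ModelOperator.HasHeatTrace.unique D hτ hτ']
  obtain ⟨c, hc, hsum⟩ := D.exists_tsum_le_heatBound hQ hW m hq
  have hmain : ∀ (P : NonharmonicTrace.PseudoOperator n D m) (t : ℝ), 0 < t → ∀ τ : ℂ,
      D.HasHeatTrace P.A q t τ →
        ‖τ‖ ≤ K * c * P.seminorm * (1 + t) * NonharmonicTrace.heatBound Q m q t := by
    intro P t ht τ hτ
    have hP := P.seminorm_nonneg
    calc ‖τ‖ ≤ K * P.seminorm * (c * (1 + t) * NonharmonicTrace.heatBound Q m q t) :=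
          (hle P t ht τ hτ).trans (mul_le_mul_of_nonneg_left (hsum t ht) (by positivity))
      _ = _ := by ring
  refine ⟨fun P t ht => ?_, ⟨K * c, by positivity, hmain⟩, fun h0 => ?_, ?_, fun hm => ?_⟩
  · obtain ⟨τ, hτ, -⟩ := htr P q t hq ht
    exact ⟨τ, hτ, fun τ' hτ' => NonharmonicTrace.ModelOperator.HasHeatTrace.unique D hτ' hτ⟩
  · obtain ⟨c', hc', hsum'⟩ := D.exists_tsum_le_heatBound_of_lam_ne_zero hQ hW m hq h0
    refine ⟨K * c', by positivity, fun P t ht τ hτ => ?_⟩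
    have hP := P.seminorm_nonneg
    calc ‖τ‖ ≤ K * P.seminorm * (c' * NonharmonicTrace.heatBound Q m q t) :=
          (hle P t ht τ hτ).trans (mul_le_mul_of_nonneg_left (hsum' t ht) (by positivity))
      _ = _ := by ring
  · rintro rfl t₀ ht₀ ht₁
    obtain ⟨c', hc', hlog⟩ := NonharmonicTrace.exists_heatBound_neg_le_log hq Q ht₀ ht₁
    refine ⟨K * c * 2 * c', by positivity, fun P t ht htt τ hτ => ?_⟩
    have hP := P.seminorm_nonneg
    have hH := NonharmonicTrace.heatBound_nonneg hq ht Q (-Q)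
    calc ‖τ‖ ≤ K * c * P.seminorm * (1 + t) * NonharmonicTrace.heatBound Q (-Q) q t :=
          hmain P t ht τ hτ
      _ ≤ K * c * P.seminorm * 2 * (c' * (-(1 / q * Real.log t))) := by
          gcongr
          · linarith
          · exact hlog t ht htt
      _ = _ := by ring
  · -- the expansion consists of its constant term, the integral over the whole half-line
    set B : ℝ := ∫ s in Set.Ioi (0 : ℝ), Real.exp (-(s ^ q)) * s ^ (Q + m - 1) with hB
    have hsupp : ∀ t : ℝ, ∀ k : ℕ, k ≠ 0 →
        (if k = 0 then B else 0) * t ^ ((k : ℝ) / q) = 0 := fun t k hk => by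
      rw [if_neg hk, zero_mul]
    refine ⟨K * c * 2, fun k => if k = 0 then B else 0, 1, by positivity, one_pos,
      fun t _ _ => summable_of_ne_finset_zero (s := {0}) fun k hk =>
        hsupp t k (by simpa using hk), fun P t ht ht1 τ hτ => ?_⟩
    have hP := P.seminorm_nonneg
    have hH := NonharmonicTrace.heatBound_nonneg hq ht Q m
    rw [tsum_eq_single 0 (hsupp t), if_pos rfl, Nat.cast_zero, zero_div, Real.rpow_zero, mul_one]
    calc ‖τ‖ ≤ K * c * P.seminorm * (1 + t) * NonharmonicTrace.heatBound Q m q t :=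
          hmain P t ht τ hτ
      _ ≤ K * c * P.seminorm * 2 * (t ^ (-((Q + m) / q)) * B) := by
          gcongr
          · linarith
          · exact NonharmonicTrace.heatBound_le_rpow_mul_integral hq hm ht
      _ = _ := by ring
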